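/- Let $k$ be a field of characteristic $0$ and let $P$ be a locally finite poset. Let $A=kP$ be the incidence algebra of $P$ over $k$: its elements are the functions $a$ on pairs $i\le j$ of $P$ with values in $k$ (formal sums $\sum_{i\le j}a(i,j)E^{ij}$), with product $(ab)(i,l)=\sum_{i\le j\le l}a(i,j)\,b(j,l)$, so that $E^{ij}E^{jl}=E^{il}$. A formal deformation of $A$ is an associative $k[[\lambda]]$-bilinear product $F=m_A+\lambda F_1+\lambda^2F_2+\cdots$ on $A[[\lambda]]$, where $m_A$ is the product of $A$, the $F_n\colon A\times A\to A$ are $k$-bilinear and extended $\lambda$-linearly, and $F(1,a)=F(a,1)=a$ for all $a\in A$. Two deformations $F,F'$ are equivalent if there is a $k[[\lambda]]$-algebra isomorphism $f\colon(A[[\lambda]],F')\to(A[[\lambda]],F)$ of the form $f=\mathrm{id}_A+\lambda f_1+\lambda^2f_2+\cdots$ with $f_n\colon A\to A$ $k$-linear. Let $W=1+\lambda k[[\lambda]]$ be the multiplicative group of big Witt vectors, and let $H^2(P;W)$ be the second simplicial cohomology group of the nerve of $P$ with coefficients in the abelian group $W$ (so a $2$-cochain is a function $\omega=1+\sum_{n\ge1}\omega_n\lambda^n$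 of the triples $i\le j\le l$ in $P$ with values in $W$). Say that a formal deformation $F$ of $kP$ is given by a $2$-cocycle $\omega$ if $F(E^{ij},E^{jl})=\omega(i,j,l)E^{il}$, meaning that for all $a,b\in kP$, $n\ge 0$ and $i,l\in P$ one has $F_n(a,b)(i,l)=\sum_{i\le j\le l}\omega_n(i,j,l)\,a(i,j)\,b(j,l)$, where $F_0=m_A$ and $\omega_0=1$. Then every class in $H^2(P;W)$ contains a cocycle that gives a formal deformation of $kP$, and there is a unique bijection $$\Psi\colon H^2(P;W)\longrightarrow\{\text{equivalence classes of formal deformations of }kP\}$$ such that $\Psi([\omega])=[F]$ whenever the formal deformation $F$ is given by the $2$-cocycle $\omega$. -/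

import Mathlib

open PowerSeries

/-! ### Formal deformations of an associative algebra

Throughout, `A⟦X⟧` is `A[[λ]]`, the variable `X` playing the role of `λ`. -/

section Deformation

variable {k A : Type*} [Field k] [Ring A] [Algebra k A]

/-- The `k[[λ]]`-linear extension to `A[[λ]]` of a family `f₀ + λ f₁ + λ² f₂ + …` of `k`-linear
endomorphisms of `A`: `∑ λ^q x_q ↦ ∑ₙ λⁿ ∑_{p + q = n} f_p (x_q)`. -/
noncomputable def formalExtend₁ (f : ℕ → A →ₗ[k] A) (x : A⟦X⟧) : A⟦X⟧ :=
  PowerSeries.mk fun n => ∑ p ∈ Finset.HasAntidiagonal.antidiagonal n, f p.1 (coeff p.2 x)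

/-- The `k[[λ]]`-bilinear extension to `A[[λ]]` of a family `F₀ + λ F₁ + λ² F₂ + …` of `k`-bilinear
maps `A × A → A`: `(x, y) ↦ ∑ₙ λⁿ ∑_{p + q + r = n} F_p (x_q, y_r)`. -/
noncomputable def formalExtend₂ (F : ℕ → A →ₗ[k] A →ₗ[k] A) (x y : A⟦X⟧) : A⟦X⟧ :=
  PowerSeries.mk fun n => ∑ p ∈ Finset.HasAntidiagonal.antidiagonal n, ∑ q ∈ Finset.HasAntidiagonal.antidiagonal p.2,
    F p.1 (coeff q.1 x) (coeff q.2 y)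

variable (k A) in
/-- A formal deformation of `A`: an associative product on `A[[λ]]` of the form
`m_A + λ F₁ + λ² F₂ + …` (extended `λ`-bilinearly) for which `1 ∈ A` is a unit. -/
structure FormalDeformation where
  /-- The coefficients `F_n` of the deformed product. -/
  term : ℕ → A →ₗ[k] A →ₗ[k] A
  term_zero : ∀ a b : A, term 0 a b = a * b
  assoc : ∀ x y z : A⟦X⟧, formalExtend₂ term (formalExtend₂ term x y) z =
    formalExtend₂ term x (formalExtend₂ term y z)
  one_left : ∀ a : A, formalExtend₂ term (C 1) (C a) = C a
  one_right : ∀ a : A, formalExtend₂ term (C a) (C 1) = C a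

/-- The deformed product on `A[[λ]]`. -/
noncomputable def FormalDeformation.mul (F : FormalDeformation k A) : A⟦X⟧ → A⟦X⟧ → A⟦X⟧ :=
  formalExtend₂ F.term

/-- Two formal deformations `F`, `F'` are equivalent if there is an algebra isomorphism
`f : (A[[λ]], F') → (A[[λ]], F)` of the form `f = id + λ f₁ + λ² f₂ + …`. -/
def FormalDeformation.Equivalent (F F' : FormalDeformation k A) : Prop :=
  ∃ f : ℕ → A →ₗ[k] A, f 0 = LinearMap.id ∧ Function.Bijective (formalExtend₁ f) ∧
    ∀ x y : A⟦X⟧, formalExtend₁ f (F'.mul x y) = F.mul (formalExtend₁ f x) (formalExtend₁ f y)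

/-- Composition of formal series of endomorphisms is the product of power series over `End A`. -/
lemma formalExtend₁_mul (f g : (Module.End k A)⟦X⟧) (x : A⟦X⟧) :
    formalExtend₁ (fun n => coeff n (f * g)) x =
      formalExtend₁ (fun n => coeff n f) (formalExtend₁ (fun n => coeff n g) x) := by
  ext n
  simp only [formalExtend₁, coeff_mk, coeff_mul, LinearMap.sum_apply, Module.End.mul_apply,
    map_sum, Finset.sum_sigma']
  apply Finset.sum_nbij' (fun ⟨⟨_i, j⟩, ⟨k, l⟩⟩ ↦ ⟨(k, l + j), (l, j)⟩)
    (fun ⟨⟨i, _j⟩, ⟨k, l⟩⟩ ↦ ⟨(i + k, l), (i, k)⟩)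
  all_goals
    rintro ⟨⟨a, b⟩, ⟨c, d⟩⟩ h
    simp only [Finset.mem_sigma, Finset.HasAntidiagonal.mem_antidiagonal] at h
    obtain ⟨h1, h2⟩ := h
    subst h2
    subst h1
    simp [add_assoc]

lemma formalExtend₁_one (x : A⟦X⟧) :
    formalExtend₁ (fun n => coeff n (1 : (Module.End k A)⟦X⟧)) x = x := by
  ext n
  simp only [formalExtend₁, coeff_mk]
  rw [Finset.sum_eq_single (0, n)]
  · simp
  · rintro ⟨p, q⟩ h hne
    have hp : p ≠ 0 := by
      rintro rfl
      simp_all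
    simp [coeff_one, hp]
  · simp

lemma FormalDeformation.Equivalent.refl (F : FormalDeformation k A) : F.Equivalent F := by
  have h := formalExtend₁_one (k := k) (A := A)
  refine ⟨fun n => coeff n (1 : (Module.End k A)⟦X⟧), ?_, ?_, fun x y => by simp only [h]⟩
  · simp [Module.End.one_eq_id]
  · rw [show formalExtend₁ (fun n => coeff n (1 : (Module.End k A)⟦X⟧)) = id from funext h]
    exact Function.bijective_id

lemma FormalDeformation.Equivalent.symm {F F' : FormalDeformation k A}
    (h : F.Equivalent F') : F'.Equivalent F := by
  obtain ⟨f, h0, -, hmul⟩ := h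
  let φ : (Module.End k A)⟦X⟧ := PowerSeries.mk f
  have hφ : (fun n => coeff n φ) = f := funext fun n => by simp [φ]
  have h1 : constantCoeff φ = ((1 : (Module.End k A)ˣ) : Module.End k A) := by
    rw [← coeff_zero_eq_constantCoeff_apply, coeff_mk, h0]
    rfl
  let ψ := invOfUnit φ 1
  have hl : ∀ x, formalExtend₁ (fun n => coeff n ψ) (formalExtend₁ f x) = x := fun x => by
    rw [← hφ, ← formalExtend₁_mul, invOfUnit_mul φ 1 h1, formalExtend₁_one]
  have hr : ∀ x, formalExtend₁ f (formalExtend₁ (fun n => coeff n ψ) x) = x := fun x => by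
    rw [← hφ, ← formalExtend₁_mul, mul_invOfUnit φ 1 h1, formalExtend₁_one]
  refine ⟨fun n => coeff n ψ, ?_, ⟨Function.LeftInverse.injective hr,
    Function.RightInverse.surjective hl⟩, fun x y => ?_⟩
  · change coeff 0 ψ = _
    rw [coeff_zero_eq_constantCoeff_apply, constantCoeff_invOfUnit]
    rfl
  · conv_lhs => rw [← hr x, ← hr y, ← hmul, hl]

lemma FormalDeformation.Equivalent.trans {F F' F'' : FormalDeformation k A}
    (h : F.Equivalent F') (h' : F'.Equivalent F'') : F.Equivalent F'' := by
  obtain ⟨f, h0, hb, hmul⟩ := h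
  obtain ⟨g, h0', hb', hmul'⟩ := h'
  let φ : (Module.End k A)⟦X⟧ := PowerSeries.mk f
  let ψ : (Module.End k A)⟦X⟧ := PowerSeries.mk g
  have hφ : (fun n => coeff n φ) = f := funext fun n => by simp [φ]
  have hψ : (fun n => coeff n ψ) = g := funext fun n => by simp [ψ]
  have hc : ∀ x, formalExtend₁ (fun n => coeff n (φ * ψ)) x =
      formalExtend₁ f (formalExtend₁ g x) := fun x => by
    rw [formalExtend₁_mul, hφ, hψ]
  refine ⟨fun n => coeff n (φ * ψ), ?_, ?_, fun x y => ?_⟩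
  · simp [coeff_mul, φ, ψ, h0, h0', Module.End.mul_eq_comp]
  · rw [show formalExtend₁ (fun n => coeff n (φ * ψ)) = formalExtend₁ f ∘ formalExtend₁ g from
      funext hc]
    exact hb.comp hb'
  · simp only [hc, hmul', hmul]

variable (k A) in
/-- Equivalence of formal deformations as an equivalence relation. -/
def FormalDeformation.setoid : Setoid (FormalDeformation k A) where
  r := FormalDeformation.Equivalent
  iseqv := ⟨FormalDeformation.Equivalent.refl, FormalDeformation.Equivalent.symm,
    FormalDeformation.Equivalent.trans⟩

variable (k A) in
/-- The set of equivalence classes of formal deformations of `A`. -/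
def DeformationClasses := Quotient (FormalDeformation.setoid k A)

/-- The equivalence class of a formal deformation. -/
def FormalDeformation.toClass (F : FormalDeformation k A) : DeformationClasses k A :=
  Quotient.mk (FormalDeformation.setoid k A) F

end Deformation

/-! ### Cohomology of a poset with coefficients in an abelian group, written multiplicatively -/

section Cohomology

variable {P G : Type*} [PartialOrder P] [CommGroup G]

variable (P G) in
/-- Simplicial `n`-cochains on the nerve of `P`: functions on the set of `n`-simplices
`v₀ ≤ v₁ ≤ ⋯ ≤ vₙ`, with pointwise multiplication. -/
abbrev PosetCochain (n : ℕ) := (Fin (n + 1) →o P) → G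

/-- The `i`-th face of a simplex: omit the vertex `vᵢ`. -/
def simplexFace {n : ℕ} (i : Fin (n + 2)) (v : Fin (n + 2) →o P) : Fin (n + 1) →o P :=
  v.comp (Fin.succAboveOrderEmb i).toOrderHom

variable (P G) in
/-- The simplicial coboundary `(dφ)(v) = ∏ᵢ φ(dᵢ v)^((-1)^i)`. -/
def posetCoboundary (n : ℕ) : PosetCochain P G n →* PosetCochain P G (n + 1) where
  toFun φ := fun v => ∏ i : Fin (n + 2), φ (simplexFace i v) ^ ((-1 : ℤ) ^ (i : ℕ))
  map_one' := by
    funext v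
    simp
  map_mul' φ ψ := by
    funext v
    simp [mul_zpow, Finset.prod_mul_distrib]

variable (P G) in
/-- The group `Z²(P; G)` of `2`-cocycles. -/
abbrev PosetZ2 : Subgroup (PosetCochain P G 2) := (posetCoboundary P G 2).ker

variable (P G) in
/-- The group `B²(P; G)` of `2`-coboundaries, as a subgroup of `Z²(P; G)`. -/
abbrev PosetB2 : Subgroup (PosetZ2 P G) := (posetCoboundary P G 1).range.subgroupOf (PosetZ2 P G)

variable (P G) in
/-- The cohomology group `H²(P; G)`. -/
abbrev PosetH2 := PosetZ2 P G ⧸ PosetB2 P G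

/-- The `2`-simplex `i ≤ j ≤ l`. -/
def simplex₂ {i j l : P} (hij : i ≤ j) (hjl : j ≤ l) : Fin 3 →o P where
  toFun := ![i, j, l]
  monotone' := by
    rw [Fin.monotone_iff_le_succ]
    intro x
    fin_cases x <;> simpa

end Cohomology

/-! ### Big Witt vectors and the deformation attached to a cocycle -/

/-- The multiplicative group `W = 1 + λ k[[λ]]` of big Witt vectors. -/
noncomputable abbrev BigWittGroup (k : Type*) [Field k] : Subgroup k⟦X⟧ˣ :=
  (Units.map (constantCoeff (R := k)).toMonoidHom).ker

/-- The deformation `F` of the incidence algebra is the one attached to the cochain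
`ω = 1 + λ ω₁ + λ² ω₂ + …`: it is given by `F (E^{ij}, E^{jl}) = ω(i, j, l) E^{il}`, that is,
`F_n (a, b)(i, l) = ∑_{i ≤ j ≤ l} ω_n(i, j, l) a(i, j) b(j, l)`. -/
def FormalDeformation.IsGivenBy {k P : Type*} [Field k] [PartialOrder P] [LocallyFiniteOrder P]
    [DecidableEq P] (F : FormalDeformation k (IncidenceAlgebra k P))
    (ω : PosetCochain P (BigWittGroup k) 2) : Prop :=
  ∀ (n : ℕ) (a b : IncidenceAlgebra k P) (i l : P),
    F.term n a b i l = ∑ j : Finset.Icc i l,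
      coeff n ((ω (simplex₂ (Finset.mem_Icc.1 j.2).1 (Finset.mem_Icc.1 j.2).2) : k⟦X⟧ˣ) : k⟦X⟧) *
        (a i j * b j l)

/-!
Let `B` be a formal deformation of `A = kP`, seen as a `λ`-adically complete `λ`-torsion free
`k[[λ]]`-algebra with `B / λB = A`. By Newton's method the diagonal matrix units lift to orthogonal
idempotents `ε i` of `B`. Since `A` is the product of its Peirce pieces `E^{ii} A E^{jj}`, the
algebra `B` is the product of the pieces `ε i B ε j`, and such a piece is free of rank one over
`k[[λ]]` on any lift of `E^{ij}` if `i ≤ j` and zero otherwise. Hence lifts of the `E^{ij}` multiply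
like matrix units up to scalars `ω(i, j, l) ∈ W`: associativity is the cocycle condition, and `ω`
determines the product of `B` in the coordinates given by the lifts. Two choices of lifts differ,
after conjugation by an element congruent to `1`, by scalars in `W`, which changes `ω` by a
coboundary.
-/

section Adic

variable {R M N : Type*} [CommRing R] [AddCommGroup M] [Module R M] [AddCommGroup N] [Module R N]
  {r : R}

lemma mem_span_singleton_pow_smul_top {n : ℕ} {x : M} :
    x ∈ (Ideal.span {r} ^ n • ⊤ : Submodule R M) ↔ ∃ y, r ^ n • y = x := by
  rw [Ideal.span_singleton_pow, Submodule.ideal_span_singleton_smul,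
    Submodule.mem_smul_pointwise_iff_exists]
  simp only [Submodule.mem_top, true_and]

lemma isHausdorff_of_jointly_injective {ι : Type*} {N : ι → Type*} [∀ i, AddCommGroup (N i)]
    [∀ i, Module R (N i)] {I : Ideal R} [∀ i, IsHausdorff I (N i)] (f : ∀ i, M →ₗ[R] N i)
    (hf : ∀ x, (∀ i, f i x = 0) → x = 0) : IsHausdorff I M where
  haus' x hx := hf x fun i => IsHausdorff.haus inferInstance (f i x) fun n =>
    SModEq.zero.2 (Submodule.smul_top_le_comap_smul_top _ (f i) (SModEq.zero.1 (hx n)))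

lemma eq_bot_of_forall_exists_smul_eq [IsHausdorff (Ideal.span {r}) M] {S : Submodule R M}
    (hS : ∀ x ∈ S, ∃ y ∈ S, r • y = x) : S = ⊥ := by
  have hpow (n : ℕ) : ∀ x ∈ S, ∃ y ∈ S, r ^ n • y = x := by
    induction n with
    | zero => exact fun x hx => ⟨x, hx, by simp⟩
    | succ n ih =>
      intro x hx
      obtain ⟨y, hy, rfl⟩ := ih x hx
      obtain ⟨z, hz, rfl⟩ := hS y hy
      exact ⟨z, hz, by rw [pow_succ, mul_smul]⟩
  refine (Submodule.eq_bot_iff S).2 fun x hx => IsHausdorff.haus ‹_› x fun n => ?_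
  obtain ⟨y, -, hy⟩ := hpow n x hx
  exact SModEq.zero.2 (mem_span_singleton_pow_smul_top.2 ⟨y, hy⟩)

lemma surjective_of_forall_exists_add_smul [IsPrecomplete (Ideal.span {r}) M]
    [IsHausdorff (Ideal.span {r}) N] (f : M →ₗ[R] N) (hf : ∀ y, ∃ x z, y = f x + r • z) :
    Function.Surjective f := by
  refine surjective_of_mkQ_comp_surjective (I := Ideal.span {r}) fun q => ?_
  obtain ⟨y, rfl⟩ := Submodule.mkQ_surjective _ q
  obtain ⟨x, z, rfl⟩ := hf y
  refine ⟨x, (Submodule.Quotient.eq _).2 ?_⟩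
  rw [sub_add_cancel_left]
  exact neg_mem (Submodule.smul_mem_smul (Ideal.mem_span_singleton_self r) Submodule.mem_top)

end Adic

section Idempotent

variable {R B : Type*} [CommRing R] [Ring B] [Algebra R B] {r : R}

/-- One step of Newton's method for the equation `x² = x`, in the form that needs no division. -/
def idempotentStep (x : B) : B := 3 * x ^ 2 - 2 * x ^ 3

lemma idempotentStep_sub_self (x : B) :
    idempotentStep x - x = (x * x - x) * (1 - 2 * x) := by
  rw [idempotentStep]
  noncomm_ring

lemma idempotentStep_mul_self_sub (x : B) :
    idempotentStep x * idempotentStep x - idempotentStep x =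
      (x * x - x) * (x * x - x) * (4 * (x * x - x) - 3) := by
  rw [idempotentStep]
  noncomm_ring

lemma exists_smul_eq_iterate_idempotentStep {x y : B} (h : r • y = x * x - x) (n : ℕ) :
    ∃ z, r ^ (n + 1) • z =
      idempotentStep^[n] x * idempotentStep^[n] x - idempotentStep^[n] x := by
  induction n with
  | zero => exact ⟨y, by simpa using h⟩
  | succ n ih =>
    obtain ⟨z, hz⟩ := ih
    refine ⟨(r ^ n • z) * z * (4 * (r ^ (n + 1) • z) - 3), ?_⟩
    rw [Function.iterate_succ_apply', idempotentStep_mul_self_sub, ← hz]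
    simp only [smul_mul_assoc, mul_smul_comm, smul_smul, ← pow_add]
    congr 2
    ring

lemma mul_self_sub_smodEq {I : Ideal R} {x y : B} (h : x ≡ y [SMOD (I • ⊤ : Submodule R B)]) :
    x * x - x ≡ y * y - y [SMOD (I • ⊤ : Submodule R B)] := by
  have hxy : x - y ∈ (I • ⊤ : Submodule R B) := SModEq.sub_mem.1 h
  have hl := Submodule.smul_top_le_comap_smul_top I (LinearMap.mulLeft R x) hxy
  have hr := Submodule.smul_top_le_comap_smul_top I (LinearMap.mulRight R y) hxy
  refine SModEq.sub (SModEq.sub_mem.2 ?_) h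
  have hsum := add_mem (Submodule.mem_comap.1 hl) (Submodule.mem_comap.1 hr)
  rwa [LinearMap.mulLeft_apply, LinearMap.mulRight_apply,
    show x * (x - y) + (x - y) * y = x * x - y * y by noncomm_ring] at hsum

lemma iterate_idempotentStep_smodEq {x y : B} (h : r • y = x * x - x) {m n : ℕ} (hmn : m ≤ n) :
    idempotentStep^[m] x ≡ idempotentStep^[n] x
      [SMOD (Ideal.span {r} ^ m • ⊤ : Submodule R B)] := by
  induction n, hmn using Nat.le_induction with
  | base => rfl
  | succ n hmn ih =>
    refine ih.trans (SModEq.mono (Submodule.pow_smul_top_le _ B hmn) (SModEq.symm ?_))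
    obtain ⟨z, hz⟩ := exists_smul_eq_iterate_idempotentStep h n
    refine SModEq.sub_mem.2 (mem_span_singleton_pow_smul_top.2
      ⟨r • z * (1 - 2 * idempotentStep^[n] x), ?_⟩)
    rw [Function.iterate_succ_apply', idempotentStep_sub_self, ← hz, pow_succ, mul_smul,
      smul_mul_assoc (r ^ n)]

theorem exists_isIdempotentElem_add_smul [IsAdicComplete (Ideal.span {r}) B] {x y : B}
    (h : r • y = x * x - x) : ∃ z, IsIdempotentElem (x + r • z) := by
  obtain ⟨e, he⟩ := IsPrecomplete.prec (I := Ideal.span {r}) inferInstance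
    (f := fun n => idempotentStep^[n] x) (iterate_idempotentStep_smodEq h)
  have hidem : e * e - e = 0 := IsHausdorff.haus inferInstance _ fun n => by
    refine (mul_self_sub_smodEq (he n)).symm.trans (SModEq.zero.2 ?_)
    obtain ⟨z, hz⟩ := exists_smul_eq_iterate_idempotentStep h n
    exact mem_span_singleton_pow_smul_top.2 ⟨r • z, by rw [← hz, pow_succ, mul_smul]⟩
  obtain ⟨z, hz⟩ := mem_span_singleton_pow_smul_top.1 (SModEq.sub_mem.1 (he 1).symm)
  refine ⟨y * (1 - 2 * x) + z, ?_⟩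
  have hx : x + r • (y * (1 - 2 * x) + z) = e := by
    rw [smul_add, ← smul_mul_assoc, h, ← idempotentStep_sub_self, ← pow_one r, hz,
      Function.iterate_one]
    abel
  rw [hx]
  exact sub_eq_zero.1 hidem

end Idempotent

section FormalLift

variable {k A B : Type*} [Field k] [Ring A] [Algebra k A] [Ring B] [Algebra k⟦X⟧ B]

variable (k) in
/-- `π : B → A` exhibits the `k[[λ]]`-algebra `B` as a flat complete lift of the `k`-algebra `A`:
`B` is `λ`-adically complete and `λ`-torsion free, and `π` is a surjection with kernel `λB` that is
linear over `k[[λ]] → k`. The model is the reduction of a formal deformation of `A`. -/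
structure IsFormalLift (π : B →+* A) : Prop where
  surjective : Function.Surjective π
  protected map_smul : ∀ (c : k⟦X⟧) (x : B), π (c • x) = constantCoeff c • π x
  exists_X_smul : ∀ x : B, π x = 0 → ∃ y : B, (X : k⟦X⟧) • y = x
  X_smul_injective : Function.Injective fun x : B => (X : k⟦X⟧) • x
  isAdicComplete : IsAdicComplete (Ideal.span {(X : k⟦X⟧)}) B

namespace IsFormalLift

variable {π : B →+* A} (hπ : IsFormalLift k π)

include hπ

lemma map_X_smul (x : B) : π ((X : k⟦X⟧) • x) = 0 := by
  rw [hπ.map_smul, constantCoeff_X, zero_smul]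

lemma submodule_eq_bot {S : Submodule k⟦X⟧ B} (hS : ∀ x ∈ S, π x = 0)
    (hX : ∀ x, (X : k⟦X⟧) • x ∈ S → x ∈ S) : S = ⊥ := by
  have := hπ.isAdicComplete
  refine eq_bot_of_forall_exists_smul_eq (r := (X : k⟦X⟧)) fun x hx => ?_
  obtain ⟨y, rfl⟩ := hπ.exists_X_smul x (hS x hx)
  exact ⟨y, hX y hx, rfl⟩

lemma exists_isIdempotentElem {e : A} (he : IsIdempotentElem e) :
    ∃ ε, IsIdempotentElem ε ∧ π ε = e := by
  have := hπ.isAdicComplete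
  obtain ⟨x, rfl⟩ := hπ.surjective e
  obtain ⟨y, hy⟩ := hπ.exists_X_smul (x * x - x) (by rw [map_sub, map_mul, he.eq, sub_self])
  obtain ⟨z, hz⟩ := exists_isIdempotentElem_add_smul hy
  exact ⟨_, hz, by rw [map_add, hπ.map_X_smul, add_zero]⟩

lemma ext_of_jointly_injective {ι : Type*} {p : ι → B →ₗ[k⟦X⟧] B} {q : ι → A → A}
    (hpq : ∀ i x, π (p i x) = q i (π x)) (hq : ∀ a, (∀ i, q i a = 0) → a = 0) {x y : B}
    (h : ∀ i, p i x = p i y) : x = y := by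
  have hbot : ⨅ i, LinearMap.ker (p i) = ⊥ := by
    refine hπ.submodule_eq_bot (fun x hx => hq _ fun i => ?_) fun x hx => ?_
    · rw [← hpq, (Submodule.mem_iInf _).1 hx i, map_zero]
    · simp only [Submodule.mem_iInf, LinearMap.mem_ker, map_smul] at hx ⊢
      exact fun i => hπ.X_smul_injective ((hx i).trans (smul_zero _).symm)
  refine sub_eq_zero.1 ((Submodule.mem_bot k⟦X⟧).1 (hbot ▸ (Submodule.mem_iInf _).2 fun i => ?_))
  rw [LinearMap.mem_ker, map_sub, h i, sub_self]

lemma exists_of_compatible_projections {ι : Type*} {p : ι → B →ₗ[k⟦X⟧] B} {q : ι → A → A}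
    (hpq : ∀ i x, π (p i x) = q i (π x)) (hp : ∀ i x, p i (p i x) = p i x)
    (hq : ∀ a : ι → A, (∀ i, q i (a i) = a i) → ∃ b, ∀ i, q i b = a i)
    {y : ι → B} (hy : ∀ i, p i (y i) = y i) : ∃ x, ∀ i, p i x = y i := by
  have := hπ.isAdicComplete
  let S : Submodule k⟦X⟧ (ι → B) :=
    Submodule.pi Set.univ fun i => LinearMap.eqLocus (p i) LinearMap.id
  have hS {z : ι → B} : z ∈ S ↔ ∀ i, p i (z i) = z i := by simp [S, Submodule.mem_pi]
  have : IsHausdorff (Ideal.span {(X : k⟦X⟧)}) S :=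
    isHausdorff_of_jointly_injective (N := fun _ : ι => B) (fun i => LinearMap.proj i ∘ₗ S.subtype)
      fun z hz => Subtype.ext (funext hz)
  let f : B →ₗ[k⟦X⟧] S := (LinearMap.pi p).codRestrict S fun x => hS.2 fun i => hp i x
  suffices Function.Surjective f by
    obtain ⟨x, hx⟩ := this ⟨y, hS.2 hy⟩
    exact ⟨x, fun i => congrFun (congrArg Subtype.val hx) i⟩
  refine surjective_of_forall_exists_add_smul (r := (X : k⟦X⟧)) f fun ⟨z, hz⟩ => ?_
  rw [hS] at hz
  obtain ⟨b, hb⟩ := hq (fun i => π (z i)) fun i => by rw [← hpq, hz]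
  obtain ⟨x, rfl⟩ := hπ.surjective b
  choose w hw using fun i => hπ.exists_X_smul (z i - p i x) (by rw [map_sub, hpq, hb, sub_self])
  refine ⟨x, ⟨w, hS.2 fun i => hπ.X_smul_injective ?_⟩, Subtype.ext (funext fun i => ?_)⟩
  · change (X : k⟦X⟧) • p i (w i) = (X : k⟦X⟧) • w i
    rw [← map_smul, hw, map_sub, hz, hp]
  · change z i = p i x + (X : k⟦X⟧) • w i
    rw [hw, add_sub_cancel]

lemma smul_left_injective {v : B} (hv : π v ≠ 0) :
    Function.Injective fun c : k⟦X⟧ => c • v := by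
  have hbot : LinearMap.ker (LinearMap.toSpanSingleton k⟦X⟧ B v) = ⊥ := by
    refine eq_bot_of_forall_exists_smul_eq (r := (X : k⟦X⟧)) fun c hc => ?_
    rw [LinearMap.mem_ker, LinearMap.toSpanSingleton_apply] at hc
    have h0 : constantCoeff c = 0 := by
      have := hπ.map_smul c v
      rw [hc, map_zero, eq_comm, smul_eq_zero] at this
      exact this.resolve_right hv
    obtain ⟨d, rfl⟩ := X_dvd_iff.2 h0
    refine ⟨d, LinearMap.mem_ker.2 (hπ.X_smul_injective ?_), rfl⟩
    simpa [mul_smul] using hc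
  exact LinearMap.ker_eq_bot.1 hbot

end IsFormalLift

end FormalLift

section SeriesModule

variable {k A : Type*} [Field k] [Ring A] [Algebra k A]

/-- `A[[λ]]` as a module over `k[[λ]]`, acting through the central map `k[[λ]] → A[[λ]]`. It is only
a local instance, as it would duplicate an existing one for some `A`. -/
noncomputable abbrev seriesModule (k A : Type*) [Field k] [Ring A] [Algebra k A] :
    Module k⟦X⟧ A⟦X⟧ :=
  Module.compHom A⟦X⟧ (PowerSeries.map (algebraMap k A))

attribute [local instance] seriesModule

lemma series_smul_def (c : k⟦X⟧) (x : A⟦X⟧) : c • x = PowerSeries.map (algebraMap k A) c * x :=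
  rfl

lemma coeff_C_smul (c : k) (x : A⟦X⟧) (n : ℕ) :
    coeff n ((C c : k⟦X⟧) • x) = c • coeff n x := by
  rw [series_smul_def, map_C, coeff_C_mul, Algebra.smul_def]

lemma coeff_smul_C (c : k⟦X⟧) (a : A) (n : ℕ) : coeff n (c • (C a : A⟦X⟧)) = coeff n c • a := by
  rw [series_smul_def, coeff_mul_C, coeff_map, Algebra.smul_def]

lemma coeff_zero_smul_series (c : k⟦X⟧) (x : A⟦X⟧) :
    coeff 0 (c • x) = constantCoeff c • coeff 0 x := by
  rw [series_smul_def, coeff_mul, Finset.Nat.antidiagonal_zero, Finset.sum_singleton, coeff_map,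
    coeff_zero_eq_constantCoeff_apply, Algebra.smul_def]

lemma X_pow_smul_series (n : ℕ) (x : A⟦X⟧) : (X ^ n : k⟦X⟧) • x = X ^ n * x := by
  rw [series_smul_def, map_pow, map_X]

lemma X_smul_series (x : A⟦X⟧) : (X : k⟦X⟧) • x = X * x := by
  rw [series_smul_def, map_X]

lemma series_smodEq_iff {n : ℕ} {x y : A⟦X⟧} :
    x ≡ y [SMOD (Ideal.span {(X : k⟦X⟧)} ^ n • ⊤ : Submodule k⟦X⟧ A⟦X⟧)] ↔
      ∀ m < n, coeff m x = coeff m y := by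
  rw [SModEq.sub_mem, mem_span_singleton_pow_smul_top]
  simp only [X_pow_smul_series, ← sub_eq_zero (a := coeff _ x), ← map_sub]
  rw [← X_pow_dvd_iff, dvd_iff_exists_eq_mul_right]
  exact exists_congr fun _ => eq_comm

instance isAdicComplete_series : IsAdicComplete (Ideal.span {(X : k⟦X⟧)}) A⟦X⟧ where
  haus' x hx := PowerSeries.ext fun n => by
    simpa using series_smodEq_iff.1 (hx (n + 1)) n n.lt_succ_self
  prec' f hf := ⟨PowerSeries.mk fun n => coeff n (f (n + 1)), fun n =>
    series_smodEq_iff.2 fun m hm => by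
      rw [coeff_mk]
      exact (series_smodEq_iff.1 (hf (Nat.succ_le_of_lt hm)) m m.lt_succ_self).symm⟩

lemma exists_eq_C_add_X_smul (x : A⟦X⟧) : ∃ y : A⟦X⟧, x = C (coeff 0 x) + (X : k⟦X⟧) • y := by
  refine ⟨PowerSeries.mk fun n => coeff (n + 1) x, ?_⟩
  rw [X_smul_series, add_comm, coeff_zero_eq_constantCoeff_apply]
  exact eq_X_mul_shift_add_const x

lemma seriesLinearMap_ext {M : Type*} [AddCommGroup M] [Module k⟦X⟧ M]
    [IsHausdorff (Ideal.span {(X : k⟦X⟧)}) M] {f g : A⟦X⟧ →ₗ[k⟦X⟧] M}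
    (h : ∀ a, f (C a) = g (C a)) : f = g := by
  suffices LinearMap.range (f - g) = ⊥ from sub_eq_zero.1 (LinearMap.range_eq_bot.1 this)
  refine eq_bot_of_forall_exists_smul_eq (r := (X : k⟦X⟧)) ?_
  rintro _ ⟨x, rfl⟩
  obtain ⟨y, hy⟩ := exists_eq_C_add_X_smul (k := k) x
  refine ⟨(f - g) y, LinearMap.mem_range_self _ y, ?_⟩
  conv_rhs => rw [hy, map_add, map_smul, LinearMap.sub_apply, h, sub_self, zero_add]

lemma formalExtend₁_smul (f : ℕ → A →ₗ[k] A) (c : k⟦X⟧) (x : A⟦X⟧) :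
    formalExtend₁ f (c • x) = c • formalExtend₁ f x := by
  have hc (y : A⟦X⟧) : c • y = formalExtend₁
      (fun n => coeff n (PowerSeries.map (algebraMap k (Module.End k A)) c)) y := by
    ext n
    simp [series_smul_def, formalExtend₁, coeff_mul, Algebra.smul_def]
  have hcomm : PowerSeries.mk f * PowerSeries.map (algebraMap k (Module.End k A)) c =
      PowerSeries.map (algebraMap k (Module.End k A)) c * PowerSeries.mk f := by
    ext1 n
    rw [coeff_mul, coeff_mul, ← Finset.Nat.sum_antidiagonal_swap]
    simp only [coeff_map, Prod.fst_swap, Prod.snd_swap, Algebra.commutes]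
  have hf (y : A⟦X⟧) :
      formalExtend₁ f y = formalExtend₁ (fun n => coeff n (PowerSeries.mk f)) y := by
    simp only [coeff_mk]
  rw [hf, hf, hc, hc, ← formalExtend₁_mul, ← formalExtend₁_mul, hcomm]

/-- `formalExtend₁` as a `k[[λ]]`-linear map. -/
noncomputable def formalExtendₗ (f : ℕ → A →ₗ[k] A) : A⟦X⟧ →ₗ[k⟦X⟧] A⟦X⟧ where
  toFun := formalExtend₁ f
  map_add' x y := by
    ext n
    simp [formalExtend₁, Finset.sum_add_distrib]
  map_smul' := formalExtend₁_smul f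

lemma coeff_formalExtend₁_C (f : ℕ → A →ₗ[k] A) (a : A) (n : ℕ) :
    coeff n (formalExtend₁ f (C a)) = f n a := by
  rw [formalExtend₁, coeff_mk, Finset.sum_eq_single_of_mem (n, 0) (by simp)]
  · simp
  · rintro ⟨p, q⟩ h hne
    have hq : q ≠ 0 := by
      rintro rfl
      simp_all
    rw [coeff_C, if_neg hq, map_zero]

lemma coeff_zero_formalExtend₁ (f : ℕ → A →ₗ[k] A) (x : A⟦X⟧) :
    coeff 0 (formalExtend₁ f x) = f 0 (coeff 0 x) := by
  simp [formalExtend₁]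

theorem exists_formalExtendₗ_eq (f : A⟦X⟧ →ₗ[k⟦X⟧] A⟦X⟧) :
    ∃ g : ℕ → A →ₗ[k] A, formalExtendₗ g = f := by
  let g (n : ℕ) : A →ₗ[k] A :=
    { toFun := fun a => coeff n (f (C a))
      map_add' := fun a b => by rw [map_add C, map_add, map_add]
      map_smul' := fun c a => by
        have hC : (C (c • a) : A⟦X⟧) = (C c : k⟦X⟧) • C a := by
          ext m
          rw [coeff_C_smul, coeff_C, coeff_C]
          split_ifs <;> simp
        rw [hC, map_smul, coeff_C_smul, RingHom.id_apply] }
  refine ⟨g, seriesLinearMap_ext fun a => PowerSeries.ext fun n => ?_⟩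
  exact coeff_formalExtend₁_C g a n

lemma formalExtend₁_bijective {f : ℕ → A →ₗ[k] A} (hf : f 0 = LinearMap.id) :
    Function.Bijective (formalExtend₁ f) := by
  have h1 : constantCoeff (PowerSeries.mk f) = ((1 : (Module.End k A)ˣ) : Module.End k A) := by
    rw [← coeff_zero_eq_constantCoeff_apply, coeff_mk, hf]
    rfl
  have hcomp (φ ψ : (Module.End k A)⟦X⟧) (h : φ * ψ = 1) :
      Function.LeftInverse (formalExtend₁ fun n => coeff n φ) (formalExtend₁ fun n => coeff n ψ) :=
    fun x => by rw [← formalExtend₁_mul, h, formalExtend₁_one]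
  have hl := hcomp _ _ (invOfUnit_mul _ 1 h1)
  have hr := hcomp _ _ (mul_invOfUnit _ 1 h1)
  simp only [coeff_mk] at hl hr
  exact ⟨hl.injective, hr.surjective⟩

lemma formalExtend₂_eq_right (F : ℕ → A →ₗ[k] A →ₗ[k] A) (x y : A⟦X⟧) :
    formalExtend₂ F x y = formalExtend₁ (fun n => ∑ p ∈ Finset.HasAntidiagonal.antidiagonal n,
      F p.1 (coeff p.2 x)) y := by
  ext n
  simp only [formalExtend₁, formalExtend₂, coeff_mk, LinearMap.sum_apply, Finset.sum_sigma']
  apply Finset.sum_nbij' (fun ⟨⟨a, _⟩, ⟨c, d⟩⟩ ↦ ⟨(a + c, d), (a, c)⟩)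
    (fun ⟨⟨_, b⟩, ⟨c, d⟩⟩ ↦ ⟨(c, d + b), (d, b)⟩)
  all_goals
    rintro ⟨⟨a, b⟩, ⟨c, d⟩⟩ h
    simp only [Finset.mem_sigma, Finset.HasAntidiagonal.mem_antidiagonal] at h
    obtain ⟨rfl, rfl⟩ := h
    simp [add_assoc]

lemma formalExtend₂_flip (F : ℕ → A →ₗ[k] A →ₗ[k] A) (x y : A⟦X⟧) :
    formalExtend₂ (fun n => (F n).flip) y x = formalExtend₂ F x y := by
  ext n
  simp only [formalExtend₂, coeff_mk, LinearMap.flip_apply]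
  refine Finset.sum_congr rfl fun p _ => ?_
  rw [← Finset.Nat.sum_antidiagonal_swap]
  rfl

lemma coeff_formalExtend₂_C (F : ℕ → A →ₗ[k] A →ₗ[k] A) (a b : A) (n : ℕ) :
    coeff n (formalExtend₂ F (C a) (C b)) = F n a b := by
  rw [formalExtend₂_eq_right, coeff_formalExtend₁_C, Finset.sum_eq_single_of_mem (n, 0) (by simp)]
  · simp
  · rintro ⟨p, q⟩ h hne
    have hq : q ≠ 0 := by
      rintro rfl
      simp_all
    rw [coeff_C, if_neg hq, map_zero]

end SeriesModule

namespace FormalDeformation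

section Algebra

variable {k A : Type*} [Field k] [Ring A] [Algebra k A]

attribute [local instance] seriesModule

/-- The `k[[λ]]`-algebra `(A[[λ]], F)`. -/
def Alg (_F : FormalDeformation k A) : Type _ := A⟦X⟧

variable (F F' : FormalDeformation k A)

noncomputable instance : AddCommGroup F.Alg := inferInstanceAs (AddCommGroup A⟦X⟧)

noncomputable instance : Module k⟦X⟧ F.Alg := inferInstanceAs (Module k⟦X⟧ A⟦X⟧)

/-- The identification of the underlying module of `(A[[λ]], F)` with `A[[λ]]`. -/
noncomputable def toSeries : F.Alg ≃ₗ[k⟦X⟧] A⟦X⟧ := LinearEquiv.refl _ _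

/-- Left multiplication by `x` in `(A[[λ]], F)`. -/
noncomputable def mulLeftₗ (x : A⟦X⟧) : A⟦X⟧ →ₗ[k⟦X⟧] A⟦X⟧ :=
  formalExtendₗ fun n => ∑ p ∈ Finset.HasAntidiagonal.antidiagonal n, F.term p.1 (coeff p.2 x)

/-- Right multiplication by `y` in `(A[[λ]], F)`. -/
noncomputable def mulRightₗ (y : A⟦X⟧) : A⟦X⟧ →ₗ[k⟦X⟧] A⟦X⟧ :=
  formalExtendₗ fun n =>
    ∑ p ∈ Finset.HasAntidiagonal.antidiagonal n, (F.term p.1).flip (coeff p.2 y)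

lemma mulLeftₗ_apply (x y : A⟦X⟧) : F.mulLeftₗ x y = F.mul x y :=
  (formalExtend₂_eq_right F.term x y).symm

lemma mulRightₗ_apply (x y : A⟦X⟧) : F.mulRightₗ y x = F.mul x y := by
  rw [mul, ← formalExtend₂_flip, formalExtend₂_eq_right]
  rfl

noncomputable instance : Mul F.Alg :=
  ⟨fun x y => F.toSeries.symm (F.mul (F.toSeries x) (F.toSeries y))⟩

noncomputable instance : One F.Alg := ⟨F.toSeries.symm (C 1)⟩

lemma toSeries_mul (x y : F.Alg) : F.toSeries (x * y) = F.mul (F.toSeries x) (F.toSeries y) :=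
  rfl

lemma toSeries_one : F.toSeries 1 = C 1 := rfl

noncomputable instance : Ring F.Alg where
  __ := (inferInstance : AddCommGroup F.Alg)
  mul_assoc x y z := F.assoc x y z
  one_mul x := by
    have : F.mulLeftₗ (C 1) = LinearMap.id := seriesLinearMap_ext fun a => by
      rw [mulLeftₗ_apply, mul, F.one_left, LinearMap.id_apply]
    rw [← F.toSeries.injective.eq_iff, toSeries_mul, toSeries_one, ← mulLeftₗ_apply, this,
      LinearMap.id_apply]
  mul_one x := by
    have : F.mulRightₗ (C 1) = LinearMap.id := seriesLinearMap_ext fun a => by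
      rw [mulRightₗ_apply, mul, F.one_right, LinearMap.id_apply]
    rw [← F.toSeries.injective.eq_iff, toSeries_mul, toSeries_one, ← mulRightₗ_apply, this,
      LinearMap.id_apply]
  left_distrib x y z := F.toSeries.injective (by
    simp only [toSeries_mul, map_add, ← mulLeftₗ_apply])
  right_distrib x y z := F.toSeries.injective (by
    simp only [toSeries_mul, map_add, ← mulRightₗ_apply])
  zero_mul x := F.toSeries.injective (by
    simp only [toSeries_mul, map_zero, ← mulRightₗ_apply])
  mul_zero x := F.toSeries.injective (by
    simp only [toSeries_mul, map_zero, ← mulLeftₗ_apply])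

noncomputable instance : Algebra k⟦X⟧ F.Alg :=
  Algebra.ofModule
    (fun c x y => F.toSeries.injective (by
      simp only [toSeries_mul, map_smul, ← mulRightₗ_apply]))
    (fun c x y => F.toSeries.injective (by
      simp only [toSeries_mul, map_smul, ← mulLeftₗ_apply]))

/-- Reduction modulo `λ`, as a ring homomorphism `(A[[λ]], F) → A`. -/
noncomputable def red : F.Alg →+* A where
  toFun x := coeff 0 (F.toSeries x)
  map_one' := coeff_zero_C 1
  map_zero' := by rw [map_zero, map_zero]
  map_add' x y := by rw [map_add, map_add]
  map_mul' x y := by simp [toSeries_mul, mul, formalExtend₂, F.term_zero]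

lemma red_apply (x : F.Alg) : F.red x = coeff 0 (F.toSeries x) := rfl

theorem isFormalLift_red : IsFormalLift k F.red where
  surjective a := ⟨F.toSeries.symm (C a), coeff_zero_C a⟩
  map_smul c x := by
    rw [red_apply, red_apply, map_smul, coeff_zero_smul_series]
  exists_X_smul x hx := by
    obtain ⟨y, hy⟩ := exists_eq_C_add_X_smul (k := k) (F.toSeries x)
    refine ⟨F.toSeries.symm y, F.toSeries.injective ?_⟩
    rw [map_smul, LinearEquiv.apply_symm_apply, hy, ← red_apply, hx, map_zero, zero_add]
  X_smul_injective x y h := by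
    have h : (X : k⟦X⟧) • F.toSeries x = (X : k⟦X⟧) • F.toSeries y := h
    rw [X_smul_series, X_smul_series] at h
    exact F.toSeries.injective (X_mul_cancel h)
  isAdicComplete := isAdicComplete_series

variable {F F'}

theorem equivalent_iff : F.Equivalent F' ↔ ∃ f : F'.Alg →ₗ[k⟦X⟧] F.Alg,
    (∀ x, F.red (f x) = F'.red x) ∧ ∀ x y, f (x * y) = f x * f y := by
  constructor
  · rintro ⟨f, h0, -, hmul⟩
    refine ⟨formalExtendₗ f, fun x => ?_, hmul⟩
    exact (coeff_zero_formalExtend₁ f x).trans (by rw [h0]; rfl)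
  · rintro ⟨f, hred, hmul⟩
    obtain ⟨g, hg⟩ := exists_formalExtendₗ_eq (k := k) (A := A) f
    have h0 : g 0 = LinearMap.id := LinearMap.ext fun a => by
      rw [← coeff_formalExtend₁_C]
      exact (congrArg (coeff 0) (LinearMap.congr_fun hg (C a))).trans
        ((hred (F'.toSeries.symm (C a))).trans (coeff_zero_C a))
    refine ⟨g, h0, formalExtend₁_bijective h0, ?_⟩
    rw [show formalExtend₁ g = f from congrArg DFunLike.coe hg]
    exact hmul

end Algebra

end FormalDeformation

section MatrixUnit

variable {R P : Type*} [Semiring R] [PartialOrder P] [DecidableEq P]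

open scoped Classical in
/-- The matrix unit `E^{ij}` of the incidence algebra of `P` over `R`; it is zero unless `i ≤ j`. -/
noncomputable def matrixUnit (R : Type*) [Semiring R] (i j : P) : IncidenceAlgebra R P where
  toFun a b := if a = i ∧ b = j ∧ i ≤ j then 1 else 0
  eq_zero_of_not_le' _ _ h := if_neg fun ⟨ha, hb, hij⟩ => h (ha ▸ hb ▸ hij)

lemma matrixUnit_apply {i j : P} (h : i ≤ j) (a b : P) :
    matrixUnit R i j a b = if a = i ∧ b = j then 1 else 0 := by
  simp [matrixUnit, h]

lemma matrixUnit_apply_self {i j : P} (h : i ≤ j) : matrixUnit R i j i j = 1 := by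
  rw [matrixUnit_apply h, if_pos ⟨rfl, rfl⟩]

lemma matrixUnit_ne_zero [Nontrivial R] {i j : P} (hij : i ≤ j) : matrixUnit R i j ≠ 0 := fun h =>
  one_ne_zero ((matrixUnit_apply_self hij).symm.trans congr($h i j))

variable [LocallyFiniteOrder P]

lemma matrixUnit_self_mul_apply (i : P) (x : IncidenceAlgebra R P) (a b : P) :
    (matrixUnit R i i * x) a b = if a = i then x i b else 0 := by
  rw [IncidenceAlgebra.mul_apply]
  simp only [matrixUnit_apply le_rfl]
  split_ifs with h
  · subst h
    by_cases hab : a ≤ b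
    · rw [Finset.sum_eq_single_of_mem a (by simpa)] <;> simp_all
    · rw [Finset.Icc_eq_empty hab, Finset.sum_empty, IncidenceAlgebra.apply_eq_zero_of_not_le hab]
  · simp [h]

lemma mul_matrixUnit_self_apply (j : P) (x : IncidenceAlgebra R P) (a b : P) :
    (x * matrixUnit R j j) a b = if b = j then x a j else 0 := by
  rw [IncidenceAlgebra.mul_apply]
  simp only [matrixUnit_apply le_rfl]
  split_ifs with h
  · subst h
    by_cases hab : a ≤ b
    · rw [Finset.sum_eq_single_of_mem b (by simpa)] <;> simp_all
    · rw [Finset.Icc_eq_empty hab, Finset.sum_empty, IncidenceAlgebra.apply_eq_zero_of_not_le hab]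
  · simp [h]

lemma isIdempotentElem_matrixUnit_self (i : P) : IsIdempotentElem (matrixUnit R i i) := by
  ext a b _
  rw [matrixUnit_self_mul_apply]
  split_ifs with h
  · rw [h]
  · simp [matrixUnit_apply, h]

lemma matrixUnit_self_mul_mul_matrixUnit_self (i j : P) (x : IncidenceAlgebra R P) :
    matrixUnit R i i * x * matrixUnit R j j = x i j • matrixUnit R i j := by
  ext a b _
  rw [mul_matrixUnit_self_apply, matrixUnit_self_mul_apply, IncidenceAlgebra.constSMul_apply]
  by_cases hij : i ≤ j
  · simp only [matrixUnit_apply hij, smul_eq_mul]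
    split_ifs <;> simp_all
  · simp [IncidenceAlgebra.apply_eq_zero_of_not_le hij]

lemma matrixUnit_mul_matrixUnit {i j l : P} (hij : i ≤ j) (hjl : j ≤ l) :
    matrixUnit R i j * matrixUnit R j l = matrixUnit R i l := by
  ext a b _
  simp only [IncidenceAlgebra.mul_apply, matrixUnit_apply hij, matrixUnit_apply hjl,
    matrixUnit_apply (hij.trans hjl)]
  by_cases h : a = i ∧ b = l
  · obtain ⟨rfl, rfl⟩ := h
    rw [Finset.sum_eq_single_of_mem j (Finset.mem_Icc.2 ⟨hij, hjl⟩)] <;> simp_all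
  · rw [if_neg h, Finset.sum_eq_zero]
    intro m _
    split_ifs <;> simp_all

end MatrixUnit

section Cochains

variable {P G : Type*} [PartialOrder P]

/-- The `1`-simplex `i ≤ j`. -/
def simplex₁ {i j : P} (hij : i ≤ j) : Fin 2 →o P where
  toFun := ![i, j]
  monotone' := by
    rw [Fin.monotone_iff_le_succ]
    intro x
    fin_cases x
    simpa

/-- The `3`-simplex `i ≤ j ≤ l ≤ m`. -/
def simplex₃ {i j l m : P} (hij : i ≤ j) (hjl : j ≤ l) (hlm : l ≤ m) : Fin 4 →o P where
  toFun := ![i, j, l, m]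
  monotone' := by
    rw [Fin.monotone_iff_le_succ]
    intro x
    fin_cases x <;> simpa

lemma exists_eq_simplex₂ (v : Fin 3 →o P) :
    ∃ (i j l : P) (hij : i ≤ j) (hjl : j ≤ l), v = simplex₂ hij hjl :=
  ⟨v 0, v 1, v 2, v.monotone (by decide), v.monotone (by decide), by
    ext x; fin_cases x <;> rfl⟩

lemma exists_eq_simplex₃ (v : Fin 4 →o P) :
    ∃ (i j l m : P) (hij : i ≤ j) (hjl : j ≤ l) (hlm : l ≤ m), v = simplex₃ hij hjl hlm :=
  ⟨v 0, v 1, v 2, v 3, v.monotone (by decide), v.monotone (by decide), v.monotone (by decide), by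
    ext x; fin_cases x <;> rfl⟩

/-- A `2`-cochain is normalized if it is trivial on the degenerate simplices `i ≤ i ≤ l` and
`i ≤ l ≤ l`. -/
def IsNormalizedCochain [One G] (ω : PosetCochain P G 2) : Prop :=
  ∀ ⦃i l : P⦄ (hil : i ≤ l),
    ω (simplex₂ (le_refl i) hil) = 1 ∧ ω (simplex₂ hil (le_refl l)) = 1

variable [CommGroup G]

lemma posetCoboundary_one_apply (φ : PosetCochain P G 1) {i j l : P} (hij : i ≤ j) (hjl : j ≤ l) :
    posetCoboundary P G 1 φ (simplex₂ hij hjl) =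
      φ (simplex₁ hjl) * (φ (simplex₁ (hij.trans hjl)))⁻¹ * φ (simplex₁ hij) := by
  have h0 : simplexFace 0 (simplex₂ hij hjl) = simplex₁ hjl := by
    ext x; fin_cases x <;> rfl
  have h1 : simplexFace 1 (simplex₂ hij hjl) = simplex₁ (hij.trans hjl) := by
    ext x; fin_cases x <;> rfl
  have h2 : simplexFace 2 (simplex₂ hij hjl) = simplex₁ hij := by
    ext x; fin_cases x <;> rfl
  change ∏ a : Fin 3, φ (simplexFace a (simplex₂ hij hjl)) ^ ((-1 : ℤ) ^ (a : ℕ)) = _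
  rw [Fin.prod_univ_three, h0, h1, h2]
  simp

lemma posetCoboundary_two_apply (ω : PosetCochain P G 2) {i j l m : P} (hij : i ≤ j) (hjl : j ≤ l)
    (hlm : l ≤ m) : posetCoboundary P G 2 ω (simplex₃ hij hjl hlm) =
      ω (simplex₂ hjl hlm) * (ω (simplex₂ (hij.trans hjl) hlm))⁻¹ *
        ω (simplex₂ hij (hjl.trans hlm)) * (ω (simplex₂ hij hjl))⁻¹ := by
  have h0 : simplexFace 0 (simplex₃ hij hjl hlm) = simplex₂ hjl hlm := by
    ext x; fin_cases x <;> rfl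
  have h1 : simplexFace 1 (simplex₃ hij hjl hlm) = simplex₂ (hij.trans hjl) hlm := by
    ext x; fin_cases x <;> rfl
  have h2 : simplexFace 2 (simplex₃ hij hjl hlm) = simplex₂ hij (hjl.trans hlm) := by
    ext x; fin_cases x <;> rfl
  have h3 : simplexFace 3 (simplex₃ hij hjl hlm) = simplex₂ hij hjl := by
    ext x; fin_cases x <;> rfl
  change ∏ a : Fin 4, ω (simplexFace a (simplex₃ hij hjl hlm)) ^ ((-1 : ℤ) ^ (a : ℕ)) = _
  rw [Fin.prod_univ_four, h0, h1, h2, h3]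
  simp [pow_succ]

lemma mem_posetZ2_iff {ω : PosetCochain P G 2} : ω ∈ PosetZ2 P G ↔
    ∀ ⦃i j l m : P⦄ (hij : i ≤ j) (hjl : j ≤ l) (hlm : l ≤ m),
      ω (simplex₂ hij hjl) * ω (simplex₂ (hij.trans hjl) hlm) =
        ω (simplex₂ hjl hlm) * ω (simplex₂ hij (hjl.trans hlm)) := by
  have coboundary_eq_one {i j l m : P} (hij : i ≤ j) (hjl : j ≤ l) (hlm : l ≤ m) :
      posetCoboundary P G 2 ω (simplex₃ hij hjl hlm) = 1 ↔
        ω (simplex₂ hij hjl) * ω (simplex₂ (hij.trans hjl) hlm) =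
          ω (simplex₂ hjl hlm) * ω (simplex₂ hij (hjl.trans hlm)) := by
    rw [posetCoboundary_two_apply, mul_inv_eq_one, mul_right_comm, mul_inv_eq_iff_eq_mul, eq_comm]
  rw [MonoidHom.mem_ker]
  refine ⟨fun h i j l m hij hjl hlm => (coboundary_eq_one hij hjl hlm).1 (congrFun h _),
    fun h => funext fun v => ?_⟩
  obtain ⟨i, j, l, m, hij, hjl, hlm, rfl⟩ := exists_eq_simplex₃ v
  exact (coboundary_eq_one hij hjl hlm).2 (h hij hjl hlm)

lemma posetH2_mk_eq_mk_iff {ω ω' : PosetZ2 P G} :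
    (QuotientGroup.mk ω : PosetH2 P G) = QuotientGroup.mk ω' ↔
      ∃ φ : PosetCochain P G 1, ∀ ⦃i j l : P⦄ (hij : i ≤ j) (hjl : j ≤ l),
        ω'.1 (simplex₂ hij hjl) * φ (simplex₁ (hij.trans hjl)) =
          ω.1 (simplex₂ hij hjl) * (φ (simplex₁ hij) * φ (simplex₁ hjl)) := by
  rw [QuotientGroup.eq, Subgroup.mem_subgroupOf, MonoidHom.mem_range]
  refine exists_congr fun φ => ?_
  have coboundary_eq {i j l : P} (hij : i ≤ j) (hjl : j ≤ l) :
      posetCoboundary P G 1 φ (simplex₂ hij hjl) = (ω⁻¹ * ω').1 (simplex₂ hij hjl) ↔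
        ω'.1 (simplex₂ hij hjl) * φ (simplex₁ (hij.trans hjl)) =
          ω.1 (simplex₂ hij hjl) * (φ (simplex₁ hij) * φ (simplex₁ hjl)) := by
    change _ = (ω.1 (simplex₂ hij hjl))⁻¹ * ω'.1 (simplex₂ hij hjl) ↔ _
    rw [posetCoboundary_one_apply, mul_right_comm, mul_inv_eq_iff_eq_mul, mul_assoc,
      eq_inv_mul_iff_mul_eq, mul_comm (φ (simplex₁ hjl)), eq_comm]
  refine ⟨fun h i j l hij hjl => (coboundary_eq hij hjl).1 (congrFun h _),
    fun h => funext fun v => ?_⟩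
  obtain ⟨i, j, l, hij, hjl, rfl⟩ := exists_eq_simplex₂ v
  exact (coboundary_eq hij hjl).2 (h hij hjl)

lemma exists_isNormalizedCochain_mk_eq (c : PosetH2 P G) :
    ∃ ω : PosetZ2 P G, QuotientGroup.mk ω = c ∧ IsNormalizedCochain ω.1 := by
  obtain ⟨⟨ω, hω⟩, rfl⟩ := QuotientGroup.mk_surjective c
  rw [mem_posetZ2_iff] at hω
  let d (j : P) : G := ω (simplex₂ (le_refl j) (le_refl j))
  have hleft {i l : P} (h : i ≤ l) : ω (simplex₂ (le_refl i) h) = d i :=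
    (mul_right_cancel (hω (le_refl i) (le_refl i) h)).symm
  have hright {i l : P} (h : i ≤ l) : ω (simplex₂ h (le_refl l)) = d l :=
    mul_right_cancel (hω h (le_refl l) (le_refl l))
  -- `v ↦ d (v 1)` is the coboundary of the `1`-cochain `v ↦ d (v 0)`
  let ω' : PosetCochain P G 2 := fun v => ω v * (d (v 1))⁻¹
  have hω' : ω' ∈ PosetZ2 P G := mem_posetZ2_iff.2 fun i j l m hij hjl hlm => by
    change ω _ * (d j)⁻¹ * (ω _ * (d l)⁻¹) = ω _ * (d l)⁻¹ * (ω _ * (d j)⁻¹)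
    rw [mul_mul_mul_comm, hω hij hjl hlm, mul_comm (d j)⁻¹, mul_mul_mul_comm]
  refine ⟨⟨ω', hω'⟩, posetH2_mk_eq_mk_iff.2 ⟨fun v => d (v 0), fun i j l hij hjl => ?_⟩,
    fun i l hil => ⟨?_, ?_⟩⟩
  · change ω _ * d i = ω _ * (d j)⁻¹ * (d i * d j)
    rw [mul_comm (d i), ← mul_assoc, inv_mul_cancel_right]
  · change ω _ * (d i)⁻¹ = 1
    rw [hleft, mul_inv_cancel]
  · change ω _ * (d l)⁻¹ = 1
    rw [hright, mul_inv_cancel]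

end Cochains

section BigWittGroup

variable {k A B : Type*} [Field k] [Ring A] [Algebra k A] [Ring B] [Algebra k⟦X⟧ B]

namespace BigWittGroup

lemma constantCoeff_coe (c : BigWittGroup k) : constantCoeff ((c : k⟦X⟧ˣ) : k⟦X⟧) = 1 :=
  congrArg Units.val (MonoidHom.mem_ker.1 c.2)

lemma exists_coe_eq {c : k⟦X⟧} (hc : constantCoeff c = 1) :
    ∃ u : BigWittGroup k, ((u : k⟦X⟧ˣ) : k⟦X⟧) = c := by
  have hunit : IsUnit c := isUnit_iff_constantCoeff.2 (by rw [hc]; exact isUnit_one)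
  exact ⟨⟨hunit.unit, MonoidHom.mem_ker.2 (Units.ext hc)⟩, rfl⟩

lemma smul_def (c : BigWittGroup k) (x : B) : c • x = ((c : k⟦X⟧ˣ) : k⟦X⟧) • x :=
  rfl

end BigWittGroup

namespace IsFormalLift

variable {π : B →+* A} (hπ : IsFormalLift k π)

include hπ

lemma map_bigWittGroup_smul (c : BigWittGroup k) (x : B) : π (c • x) = π x := by
  rw [BigWittGroup.smul_def, hπ.map_smul, BigWittGroup.constantCoeff_coe, one_smul]

lemma bigWittGroup_smul_left_injective {v : B} (hv : π v ≠ 0) :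
    Function.Injective fun c : BigWittGroup k => c • v := fun _ _ h =>
  Subtype.ext (Units.ext (hπ.smul_left_injective hv h))

end IsFormalLift

end BigWittGroup

section Peirce

variable {k P B : Type*} [Field k] [PartialOrder P] [LocallyFiniteOrder P] [DecidableEq P]
  [Ring B] [Algebra k⟦X⟧ B]

namespace IsFormalLift

variable {π : B →+* IncidenceAlgebra k P} (hπ : IsFormalLift k π)

include hπ

section DiagonalLift

variable {ε : P → B} (hε : ∀ i, π (ε i) = matrixUnit k i i)

include hε

lemma ext_of_mul_left {x y : B} (h : ∀ i, ε i * x = ε i * y) : x = y := by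
  refine hπ.ext_of_jointly_injective (p := fun i => LinearMap.mulLeft k⟦X⟧ (ε i))
    (q := fun i a => matrixUnit k i i * a) (fun i x => ?_) (fun a ha => ?_) h
  · rw [LinearMap.mulLeft_apply, map_mul, hε]
  · ext i j _
    rw [← congr($(ha i) i j), matrixUnit_self_mul_apply, if_pos rfl]

lemma ext_of_mul_right {x y : B} (h : ∀ j, x * ε j = y * ε j) : x = y := by
  refine hπ.ext_of_jointly_injective (p := fun j => LinearMap.mulRight k⟦X⟧ (ε j))
    (q := fun j a => a * matrixUnit k j j) (fun j x => ?_) (fun a ha => ?_) h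
  · rw [LinearMap.mulRight_apply, map_mul, hε]
  · ext i j _
    rw [← congr($(ha j) i j), mul_matrixUnit_self_apply, if_pos rfl]

variable (hidem : ∀ i, IsIdempotentElem (ε i))

include hidem

lemma exists_mul_left_eq {y : P → B} (hy : ∀ i, ε i * y i = y i) : ∃ x, ∀ i, ε i * x = y i := by
  refine hπ.exists_of_compatible_projections (p := fun i => LinearMap.mulLeft k⟦X⟧ (ε i))
    (q := fun i a => matrixUnit k i i * a) (fun i x => ?_) (fun i x => ?_) (fun a ha => ?_) hy
  · rw [LinearMap.mulLeft_apply, map_mul, hε]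
  · rw [LinearMap.mulLeft_apply, LinearMap.mulLeft_apply, ← mul_assoc, (hidem i).eq]
  · refine ⟨⟨fun i j => a i i j, fun i j => (a i).apply_eq_zero_of_not_le⟩, fun i => ?_⟩
    rw [← ha i]
    ext b c _
    simp only [matrixUnit_self_mul_apply]
    rfl

lemma exists_mul_right_eq {y : P → B} (hy : ∀ j, y j * ε j = y j) : ∃ x, ∀ j, x * ε j = y j := by
  refine hπ.exists_of_compatible_projections (p := fun j => LinearMap.mulRight k⟦X⟧ (ε j))
    (q := fun j a => a * matrixUnit k j j) (fun j x => ?_) (fun j x => ?_) (fun a ha => ?_) hy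
  · rw [LinearMap.mulRight_apply, map_mul, hε]
  · rw [LinearMap.mulRight_apply, LinearMap.mulRight_apply, mul_assoc, (hidem j).eq]
  · refine ⟨⟨fun i j => a j i j, fun i j => (a j).apply_eq_zero_of_not_le⟩, fun j => ?_⟩
    rw [← ha j]
    ext b c _
    simp only [mul_matrixUnit_self_apply]
    rfl

lemma exists_mul_mul_eq {y : P → P → B} (hl : ∀ i j, ε i * y i j = y i j)
    (hr : ∀ i j, y i j * ε j = y i j) : ∃ x, ∀ i j, ε i * x * ε j = y i j := by
  choose row hrow using fun i => hπ.exists_mul_right_eq hε hidem (hr i)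
  obtain ⟨x, hx⟩ := hπ.exists_mul_left_eq hε hidem (y := row) fun i =>
    hπ.ext_of_mul_right hε fun j => by rw [mul_assoc, hrow, hl]
  exact ⟨x, fun i j => by rw [hx, hrow]⟩

lemma exists_diagonal_algHom : ∃ δ : (P → k⟦X⟧) →ₐ[k⟦X⟧] B, ∀ d i, ε i * δ d = d i • ε i := by
  choose δ hδ using fun d : P → k⟦X⟧ =>
    hπ.exists_mul_left_eq hε hidem (y := fun i => d i • ε i) fun i => by
      rw [mul_smul_comm, (hidem i).eq]
  refine ⟨AlgHom.ofLinearMap ⟨⟨δ, fun d d' => ?_⟩, fun c d => ?_⟩ ?_ fun d d' => ?_, hδ⟩ <;>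
    refine hπ.ext_of_mul_left hε fun i => ?_
  · rw [mul_add, hδ, hδ, hδ, Pi.add_apply, add_smul]
  · rw [RingHom.id_apply, mul_smul_comm, hδ, hδ, Pi.smul_apply, smul_assoc]
  · exact (hδ 1 i).trans (by rw [Pi.one_apply, one_smul, mul_one])
  · change ε i * δ (d * d') = ε i * (δ d * δ d')
    rw [← mul_assoc, hδ, hδ, smul_mul_assoc, hδ, Pi.mul_apply, mul_smul]

end DiagonalLift

lemma exists_orthogonal_diagonal :
    ∃ η : P → B, (∀ i, π (η i) = matrixUnit k i i) ∧ OrthogonalIdempotents η := by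
  choose ε hidem hε using fun i : P =>
    hπ.exists_isIdempotentElem (isIdempotentElem_matrixUnit_self (R := k) i)
  obtain ⟨δ, hδ⟩ := hπ.exists_diagonal_algHom hε hidem
  have horth : OrthogonalIdempotents fun i : P => (Pi.single i 1 : P → k⟦X⟧) :=
    ⟨fun i => by rw [IsIdempotentElem, ← Pi.single_mul, one_mul], fun i j hij => by
      funext a
      simp only [Pi.mul_apply, Pi.single_apply]
      split_ifs <;> simp_all⟩
  refine ⟨fun i => δ (Pi.single i 1), fun i => ?_, horth.map δ.toRingHom⟩
  ext a b _
  have := congr(π $(hδ (Pi.single i 1) a) a b)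
  rw [map_mul, hπ.map_smul, hε, matrixUnit_self_mul_apply, if_pos rfl] at this
  rw [this, IncidenceAlgebra.constSMul_apply, matrixUnit_apply le_rfl, matrixUnit_apply le_rfl,
    Pi.single_apply]
  split_ifs <;> simp_all

lemma exists_smul_eq_of_mul_eq {i j : P} {e f v x : B} (he : π e = matrixUnit k i i)
    (hf : π f = matrixUnit k j j) (hv : π v = matrixUnit k i j) (hev : e * v = v)
    (hvf : v * f = v) (hex : e * x = x) (hxf : x * f = x) : ∃ c : k⟦X⟧, x = c • v := by
  have := hπ.isAdicComplete
  let S : Submodule k⟦X⟧ B := LinearMap.eqLocus (LinearMap.mulLeft k⟦X⟧ e) LinearMap.id ⊓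
    LinearMap.eqLocus (LinearMap.mulRight k⟦X⟧ f) LinearMap.id
  have mem_S {z : B} : z ∈ S ↔ e * z = z ∧ z * f = z := by simp [S]
  have : IsHausdorff (Ideal.span {(X : k⟦X⟧)}) S :=
    isHausdorff_of_jointly_injective (N := fun _ : Unit => B) (fun _ => S.subtype)
      fun z hz => Subtype.ext (hz ())
  let g : k⟦X⟧ →ₗ[k⟦X⟧] S := LinearMap.toSpanSingleton k⟦X⟧ S ⟨v, mem_S.2 ⟨hev, hvf⟩⟩
  suffices Function.Surjective g by
    obtain ⟨c, hc⟩ := this ⟨x, mem_S.2 ⟨hex, hxf⟩⟩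
    exact ⟨c, congrArg Subtype.val hc.symm⟩
  refine surjective_of_forall_exists_add_smul (r := (X : k⟦X⟧)) g fun ⟨z, hz⟩ => ?_
  rw [mem_S] at hz
  let c : k⟦X⟧ := C (π z i j)
  have hπz : π (z - c • v) = 0 := by
    rw [map_sub, hπ.map_smul, hv, constantCoeff_C, ← matrixUnit_self_mul_mul_matrixUnit_self, ← he,
      ← hf, ← map_mul, ← map_mul, hz.1, hz.2, sub_self]
  obtain ⟨w, hw⟩ := hπ.exists_X_smul _ hπz
  have hwS : w ∈ S := mem_S.2 ⟨hπ.X_smul_injective <| by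
    change (X : k⟦X⟧) • (e * w) = (X : k⟦X⟧) • w
    rw [← mul_smul_comm, hw, mul_sub, hz.1, mul_smul_comm, hev], hπ.X_smul_injective <| by
    change (X : k⟦X⟧) • (w * f) = (X : k⟦X⟧) • w
    rw [← smul_mul_assoc, hw, sub_mul, hz.2, smul_mul_assoc, hvf]⟩
  refine ⟨c, ⟨w, hwS⟩, Subtype.ext ?_⟩
  change z = c • v + (X : k⟦X⟧) • w
  rw [hw, add_sub_cancel]

lemma exists_bigWittGroup_smul_eq {i j : P} (hij : i ≤ j) {e f v x : B}
    (he : π e = matrixUnit k i i) (hf : π f = matrixUnit k j j) (hv : π v = matrixUnit k i j)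
    (hev : e * v = v) (hvf : v * f = v) (hex : e * x = x) (hxf : x * f = x)
    (hx : π x = matrixUnit k i j) : ∃ c : BigWittGroup k, x = c • v := by
  obtain ⟨c, rfl⟩ := hπ.exists_smul_eq_of_mul_eq he hf hv hev hvf hex hxf
  have hc : constantCoeff c = 1 := by
    have := congr($hx i j)
    rwa [hπ.map_smul, hv, IncidenceAlgebra.constSMul_apply, matrixUnit_apply_self hij,
      smul_eq_mul, mul_one] at this
  obtain ⟨u, rfl⟩ := BigWittGroup.exists_coe_eq hc
  exact ⟨u, rfl⟩

section Orthogonal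

variable {ε : P → B} (hε : ∀ i, π (ε i) = matrixUnit k i i) (horth : OrthogonalIdempotents ε)

include hε horth

lemma mul_mul_eq_zero_of_not_le {i j : P} (hij : ¬i ≤ j) (x : B) : ε i * x * ε j = 0 := by
  have hπ0 : π 0 = matrixUnit k i j := by
    ext a b _
    simp [matrixUnit, hij]
  obtain ⟨c, hc⟩ := hπ.exists_smul_eq_of_mul_eq (x := ε i * x * ε j) (hε i) (hε j) hπ0
    (mul_zero _) (zero_mul _) (by simp only [← mul_assoc, (horth.idem i).eq])
    (by rw [mul_assoc, (horth.idem j).eq])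
  rw [hc, smul_zero]

lemma exists_diagonal_algHom_of_orthogonalIdempotents : ∃ δ : (P → k⟦X⟧) →ₐ[k⟦X⟧] B,
    (∀ d i, ε i * δ d = d i • ε i) ∧ (∀ d i, δ d * ε i = d i • ε i) ∧
      ∀ i, δ (Pi.single i 1) = ε i := by
  obtain ⟨δ, hδ⟩ := hπ.exists_diagonal_algHom hε horth.idem
  refine ⟨δ, hδ, fun d i => ?_, fun i => ?_⟩ <;> refine hπ.ext_of_mul_left hε fun j => ?_
  · rw [← mul_assoc, hδ, smul_mul_assoc, mul_smul_comm, horth.mul_eq]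
    split_ifs with h
    · rw [h]
    · rw [smul_zero, smul_zero]
  · rw [hδ, horth.mul_eq, Pi.single_apply]
    split_ifs <;> simp

lemma mul_mul_mul_eq_sum (x y : B) (i l : P) :
    ε i * (x * y) * ε l = ∑ j : Finset.Icc i l, ε i * x * ε j * (ε j * y * ε l) := by
  classical
  obtain ⟨δ, hδ_left, hδ_right, hδ_single⟩ :=
    hπ.exists_diagonal_algHom_of_orthogonalIdempotents hε horth
  have hx : ε i * x * δ ((Set.Ici i).indicator 1) = ε i * x :=
    hπ.ext_of_mul_right hε fun j => by
      rw [mul_assoc _ (δ _), hδ_right, mul_smul_comm]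
      by_cases hij : i ≤ j
      · rw [Set.indicator_of_mem (Set.mem_Ici.2 hij), Pi.one_apply, one_smul]
      · rw [hπ.mul_mul_eq_zero_of_not_le hε horth hij, smul_zero]
  have hy : δ ((Set.Iic l).indicator 1) * (y * ε l) = y * ε l :=
    hπ.ext_of_mul_left hε fun j => by
      rw [← mul_assoc, hδ_left, smul_mul_assoc, ← mul_assoc]
      by_cases hjl : j ≤ l
      · rw [Set.indicator_of_mem (Set.mem_Iic.2 hjl), Pi.one_apply, one_smul]
      · rw [hπ.mul_mul_eq_zero_of_not_le hε horth hjl, smul_zero]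
  -- the indicators of `[i, ∞)` and `(-∞, l]` multiply to that of the finite interval `[i, l]`
  have hsum : (Set.Ici i).indicator (1 : P → k⟦X⟧) * (Set.Iic l).indicator 1 =
      ∑ j : Finset.Icc i l, Pi.single (j : P) 1 := by
    rw [Finset.sum_coe_sort (Finset.Icc i l) fun j => (Pi.single j 1 : P → k⟦X⟧)]
    funext a
    simp [Finset.sum_apply, Pi.single_apply, Set.indicator_apply, ← ite_and, and_comm]
  calc ε i * (x * y) * ε l
      = ε i * x * δ ((Set.Ici i).indicator 1) * (δ ((Set.Iic l).indicator 1) * (y * ε l)) := by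
        rw [hx, hy]; simp only [mul_assoc]
    _ = ε i * x * δ ((Set.Ici i).indicator 1 * (Set.Iic l).indicator 1) * (y * ε l) := by
        rw [map_mul]; simp only [mul_assoc]
    _ = ∑ j : Finset.Icc i l, ε i * x * ε j * (y * ε l) := by
        rw [hsum, map_sum, Finset.mul_sum, Finset.sum_mul]
        simp only [hδ_single]
    _ = ∑ j : Finset.Icc i l, ε i * x * ε j * (ε j * y * ε l) :=
        Finset.sum_congr rfl fun j _ => by
          rw [mul_assoc (ε j), ← mul_assoc (ε i * x * ε j) (ε j), mul_assoc (ε i * x) (ε j) (ε j),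
            (horth.idem j).eq]

end Orthogonal

end IsFormalLift

end Peirce

section Frame

variable {k P B : Type*} [Field k] [PartialOrder P] [LocallyFiniteOrder P] [DecidableEq P]
  [Ring B] [Algebra k⟦X⟧ B]

/-- A frame with structure cochain `ω`: lifts `E i j` (meaningful only for `i ≤ j`) to `B` of the
matrix units of the incidence algebra, multiplying like matrix units up to the scalars `ω`. -/
structure IsFrame (π : B →+* IncidenceAlgebra k P) (ω : PosetCochain P (BigWittGroup k) 2)
    (E : P → P → B) : Prop where
  isNormalizedCochain : IsNormalizedCochain ω
  map_eq : ∀ ⦃i j⦄, i ≤ j → π (E i j) = matrixUnit k i j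
  mul_eq : ∀ ⦃i j l⦄ (hij : i ≤ j) (hjl : j ≤ l), E i j * E j l = ω (simplex₂ hij hjl) • E i l
  diag_mul_diag_eq_zero : Pairwise fun i j => E i i * E j j = 0

namespace IsFrame

variable {π : B →+* IncidenceAlgebra k P} {ω ω' : PosetCochain P (BigWittGroup k) 2}
  {E V : P → P → B}

lemma diag_mul (hE : IsFrame π ω E) {i j : P} (hij : i ≤ j) : E i i * E i j = E i j := by
  rw [hE.mul_eq le_rfl hij, (hE.isNormalizedCochain hij).1, one_smul]

lemma mul_diag (hE : IsFrame π ω E) {i j : P} (hij : i ≤ j) : E i j * E j j = E i j := by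
  rw [hE.mul_eq hij le_rfl, (hE.isNormalizedCochain hij).2, one_smul]

lemma orthogonalIdempotents (hE : IsFrame π ω E) : OrthogonalIdempotents fun i => E i i :=
  ⟨fun _ => hE.diag_mul le_rfl, hE.diag_mul_diag_eq_zero⟩

lemma map_diag (hE : IsFrame π ω E) (i : P) : π (E i i) = matrixUnit k i i :=
  hE.map_eq le_rfl

lemma mem_posetZ2 (hπ : IsFormalLift k π) (hE : IsFrame π ω E) :
    ω ∈ PosetZ2 P (BigWittGroup k) := by
  refine mem_posetZ2_iff.2 fun i j l m hij hjl hlm =>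
    hπ.bigWittGroup_smul_left_injective (v := E i m) ?_ ?_
  · rw [hE.map_eq (hij.trans (hjl.trans hlm))]
    exact matrixUnit_ne_zero (hij.trans (hjl.trans hlm))
  · calc (ω (simplex₂ hij hjl) * ω (simplex₂ (hij.trans hjl) hlm)) • E i m
        = E i j * E j l * E l m := by
          rw [hE.mul_eq hij hjl, smul_mul_assoc, hE.mul_eq (hij.trans hjl) hlm, mul_smul]
      _ = (ω (simplex₂ hjl hlm) * ω (simplex₂ hij (hjl.trans hlm))) • E i m := by
          rw [mul_assoc, hE.mul_eq hjl hlm, mul_smul_comm, hE.mul_eq hij (hjl.trans hlm), mul_smul]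

lemma exists_of_coboundary (hπ : IsFormalLift k π) (hE : IsFrame π ω E)
    (hω' : IsNormalizedCochain ω')
    {φ : PosetCochain P (BigWittGroup k) 1}
    (hφ : ∀ ⦃i j l : P⦄ (hij : i ≤ j) (hjl : j ≤ l),
      ω' (simplex₂ hij hjl) * φ (simplex₁ (hij.trans hjl)) =
        ω (simplex₂ hij hjl) * (φ (simplex₁ hij) * φ (simplex₁ hjl))) :
    ∃ V, IsFrame π ω' V := by
  classical
  have hφ_diag (i : P) : φ (simplex₁ (le_refl i)) = 1 := by
    have := hφ (le_refl i) (le_refl i)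
    rwa [(hω' le_rfl).1, (hE.isNormalizedCochain le_rfl).1, one_mul, one_mul, eq_comm,
      mul_eq_left] at this
  let V (i j : P) : B := if hij : i ≤ j then φ (simplex₁ hij) • E i j else 0
  have hV {i j : P} (hij : i ≤ j) : V i j = φ (simplex₁ hij) • E i j := dif_pos hij
  refine ⟨V, hω', fun i j hij => ?_, fun i j l hij hjl => ?_, fun i j hij => ?_⟩
  · rw [hV hij, hπ.map_bigWittGroup_smul, hE.map_eq hij]
  · rw [hV hij, hV hjl, hV (hij.trans hjl), smul_mul_smul_comm, hE.mul_eq, ← mul_smul, ← mul_smul,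
      hφ, mul_comm]
  · change V i i * V j j = 0
    rw [hV le_rfl, hV le_rfl, hφ_diag, hφ_diag, one_smul, one_smul, hE.diag_mul_diag_eq_zero hij]

lemma map {B' : Type*} [Ring B'] [Algebra k⟦X⟧ B'] {π' : B' →+* IncidenceAlgebra k P}
    (hE : IsFrame π ω E) {f : B →ₗ[k⟦X⟧] B'} (hf : ∀ x, π' (f x) = π x)
    (hmul : ∀ x y, f (x * y) = f x * f y) : IsFrame π' ω fun i j => f (E i j) where
  isNormalizedCochain := hE.isNormalizedCochain
  map_eq i j hij := by rw [hf, hE.map_eq hij]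
  mul_eq i j l hij hjl := by
    rw [← hmul, hE.mul_eq, BigWittGroup.smul_def, BigWittGroup.smul_def, map_smul]
  diag_mul_diag_eq_zero i j hij := by
    change f (E i i) * f (E j j) = 0
    rw [← hmul, hE.diag_mul_diag_eq_zero hij, map_zero]

end IsFrame

namespace IsFormalLift

variable {π : B →+* IncidenceAlgebra k P} (hπ : IsFormalLift k π)

include hπ

lemma exists_matrixUnit_lift : ∃ E : P → P → B,
    (∀ ⦃i j⦄, i ≤ j → π (E i j) = matrixUnit k i j) ∧
    (∀ i j, E i i * E i j = E i j) ∧ (∀ i j, E i j * E j j = E i j) ∧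
    Pairwise fun i j => E i i * E j j = 0 := by
  obtain ⟨η, hη, horth⟩ := hπ.exists_orthogonal_diagonal
  choose s hs using hπ.surjective
  let E (i j : P) : B := if i = j then η i else η i * s (matrixUnit k i j) * η j
  have hE_diag (i : P) : E i i = η i := if_pos rfl
  refine ⟨E, fun i j hij => ?_, fun i j => ?_, fun i j => ?_, fun i j hij => ?_⟩
  · dsimp only [E]
    split_ifs with h
    · rw [hη, h]
    · rw [map_mul, map_mul, hη, hη, hs, matrixUnit_self_mul_mul_matrixUnit_self,
        matrixUnit_apply_self hij, one_smul]
  · rw [hE_diag]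
    dsimp only [E]
    split_ifs
    · exact horth.idem i
    · simp only [← mul_assoc, (horth.idem i).eq]
  · rw [hE_diag]
    dsimp only [E]
    split_ifs with h
    · exact h ▸ horth.idem i
    · rw [mul_assoc, (horth.idem j).eq]
  · change E i i * E j j = 0
    rw [hE_diag, hE_diag, horth.ortho hij]

lemma exists_isFrame_of_lift {E : P → P → B}
    (hE_map : ∀ ⦃i j⦄, i ≤ j → π (E i j) = matrixUnit k i j)
    (hE_left : ∀ i j, E i i * E i j = E i j) (hE_right : ∀ i j, E i j * E j j = E i j)
    (hE_orth : Pairwise fun i j => E i i * E j j = 0) : ∃ ω, IsFrame π ω E := by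
  have hE_mul (v : Fin 3 →o P) : ∃ c : BigWittGroup k,
      E (v 0) (v 1) * E (v 1) (v 2) = c • E (v 0) (v 2) := by
    have h01 : v 0 ≤ v 1 := v.monotone (by decide)
    have h12 : v 1 ≤ v 2 := v.monotone (by decide)
    refine hπ.exists_bigWittGroup_smul_eq (h01.trans h12) (hE_map le_rfl) (hE_map le_rfl)
      (hE_map (h01.trans h12)) (hE_left _ _) (hE_right _ _) (by rw [← mul_assoc, hE_left])
      (by rw [mul_assoc, hE_right]) ?_
    rw [map_mul, hE_map h01, hE_map h12, matrixUnit_mul_matrixUnit h01 h12]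
  choose ω hω using hE_mul
  have hω' {i j l : P} (hij : i ≤ j) (hjl : j ≤ l) :
      E i j * E j l = ω (simplex₂ hij hjl) • E i l := hω (simplex₂ hij hjl)
  refine ⟨ω, fun i l hil => ?_, hE_map, fun _ _ _ => hω', hE_orth⟩
  have hfree := hπ.bigWittGroup_smul_left_injective (hE_map hil ▸ matrixUnit_ne_zero hil)
  constructor <;> apply hfree <;> beta_reduce
  · rw [← hω', hE_left, one_smul]
  · rw [← hω', hE_right, one_smul]

theorem exists_isFrame : ∃ ω E, IsFrame π ω E := by
  obtain ⟨E, hE_map, hE_left, hE_right, hE_orth⟩ := hπ.exists_matrixUnit_lift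
  obtain ⟨ω, hω⟩ := hπ.exists_isFrame_of_lift hE_map hE_left hE_right hE_orth
  exact ⟨ω, E, hω⟩

end IsFormalLift

namespace IsFrame

variable {π : B →+* IncidenceAlgebra k P} {ω ω' : PosetCochain P (BigWittGroup k) 2}
  {E V : P → P → B}

lemma exists_intertwiner (hπ : IsFormalLift k π) (hE : IsFrame π ω E) (hV : IsFrame π ω' V) :
    ∃ u, π u = 1 ∧ ∀ i, E i i * u = u * V i i := by
  -- `u` is the (infinite) sum of the products `E i i * V i i`
  obtain ⟨u, hu⟩ := hπ.exists_mul_left_eq hE.map_diag hE.orthogonalIdempotents.idem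
    (y := fun i => E i i * V i i) fun i => by rw [← mul_assoc, hE.diag_mul le_rfl]
  refine ⟨u, ?_, fun i => (hu i).trans (hπ.ext_of_mul_left hE.map_diag fun j => ?_)⟩
  · ext a b _
    have := congr(π $(hu a) a b)
    rw [map_mul, map_mul, hE.map_diag, hV.map_diag, matrixUnit_self_mul_apply,
      matrixUnit_self_mul_apply, if_pos rfl, if_pos rfl, matrixUnit_apply le_rfl] at this
    rw [this, IncidenceAlgebra.one_apply]
    simp only [true_and, eq_comm (a := b)]
  · rw [← mul_assoc, ← mul_assoc, hu, mul_assoc (E j j) (V j j),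
      hE.orthogonalIdempotents.mul_eq, hV.orthogonalIdempotents.mul_eq]
    split_ifs with h
    · subst h; rfl
    · rw [zero_mul, mul_zero]

theorem cohomologous (hπ : IsFormalLift k π) (hE : IsFrame π ω E) (hV : IsFrame π ω' V) :
    ∃ φ : PosetCochain P (BigWittGroup k) 1, ∀ ⦃i j l : P⦄ (hij : i ≤ j) (hjl : j ≤ l),
      ω' (simplex₂ hij hjl) * φ (simplex₁ (hij.trans hjl)) =
        ω (simplex₂ hij hjl) * (φ (simplex₁ hij) * φ (simplex₁ hjl)) := by
  obtain ⟨u, hu_map, hu⟩ := exists_intertwiner hπ hE hV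
  have hφ (v : Fin 2 →o P) :
      ∃ c : BigWittGroup k, u * V (v 0) (v 1) = c • (E (v 0) (v 1) * u) := by
    have hv : v 0 ≤ v 1 := v.monotone (by decide)
    refine hπ.exists_bigWittGroup_smul_eq hv (hE.map_diag _) (hV.map_diag _) ?_ ?_ ?_ ?_ ?_ ?_
    · rw [map_mul, hu_map, mul_one, hE.map_eq hv]
    · rw [← mul_assoc, hE.diag_mul hv]
    · rw [mul_assoc, ← hu, ← mul_assoc, hE.mul_diag hv]
    · rw [← mul_assoc, hu, mul_assoc, hV.diag_mul hv]
    · rw [mul_assoc, hV.mul_diag hv]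
    · rw [map_mul, hu_map, one_mul, hV.map_eq hv]
  choose φ hφ using hφ
  have hφ' {i j : P} (hij : i ≤ j) : u * V i j = φ (simplex₁ hij) • (E i j * u) :=
    hφ (simplex₁ hij)
  refine ⟨φ, fun i j l hij hjl => ?_⟩
  refine hπ.bigWittGroup_smul_left_injective (v := E i l * u) ?_ ?_
  · rw [map_mul, hu_map, mul_one, hE.map_eq (hij.trans hjl)]
    exact matrixUnit_ne_zero (hij.trans hjl)
  · calc (ω' (simplex₂ hij hjl) * φ (simplex₁ (hij.trans hjl))) • (E i l * u)
        = u * (V i j * V j l) := by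
          rw [hV.mul_eq, mul_smul_comm, hφ' (hij.trans hjl), mul_smul]
      _ = φ (simplex₁ hij) • φ (simplex₁ hjl) • (E i j * E j l * u) := by
          rw [← mul_assoc, hφ' hij, smul_mul_assoc, mul_assoc, hφ' hjl, mul_smul_comm, mul_assoc]
      _ = (ω (simplex₂ hij hjl) * (φ (simplex₁ hij) * φ (simplex₁ hjl))) • (E i l * u) := by
          rw [hE.mul_eq, smul_mul_assoc, ← mul_smul, ← mul_smul, mul_comm (ω _)]

lemma exists_coordinates (hπ : IsFormalLift k π) (hE : IsFrame π ω E) :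
    ∃ κ : B ≃ₗ[k⟦X⟧] IncidenceAlgebra k⟦X⟧ P, ∀ x i j, E i i * x * E j j = κ x i j • E i j := by
  have hcoord (x : B) (i j : P) :
      ∃ c : k⟦X⟧, E i i * x * E j j = c • E i j ∧ (¬i ≤ j → c = 0) := by
    by_cases hij : i ≤ j
    · obtain ⟨c, hc⟩ := hπ.exists_smul_eq_of_mul_eq (x := E i i * x * E j j) (hE.map_diag i)
        (hE.map_diag j) (hE.map_eq hij) (hE.diag_mul hij) (hE.mul_diag hij)
        (by simp only [← mul_assoc, hE.diag_mul le_rfl]) (by rw [mul_assoc, hE.diag_mul le_rfl])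
      exact ⟨c, hc, fun h => absurd hij h⟩
    · refine ⟨0, ?_, fun _ => rfl⟩
      rw [hπ.mul_mul_eq_zero_of_not_le hE.map_diag hE.orthogonalIdempotents hij, zero_smul]
  choose c hc hc0 using hcoord
  have hinj {i j : P} (hij : i ≤ j) := hπ.smul_left_injective
    (v := E i j) (hE.map_eq hij ▸ matrixUnit_ne_zero hij)
  let κ : B →ₗ[k⟦X⟧] IncidenceAlgebra k⟦X⟧ P :=
    { toFun x := ⟨c x, hc0 x⟩
      map_add' x y := IncidenceAlgebra.ext fun i j hij => hinj hij <| by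
        change c (x + y) i j • E i j = (c x i j + c y i j) • E i j
        rw [add_smul, ← hc, ← hc, ← hc, mul_add, add_mul]
      map_smul' a x := IncidenceAlgebra.ext fun i j hij => hinj hij <| by
        change c (a • x) i j • E i j = (a * c x i j) • E i j
        rw [mul_smul, ← hc, ← hc, mul_smul_comm, smul_mul_assoc] }
  refine ⟨LinearEquiv.ofBijective κ ⟨fun x y hxy => ?_, fun d => ?_⟩, hc⟩
  · refine hπ.ext_of_mul_left hE.map_diag fun i => hπ.ext_of_mul_right hE.map_diag fun j => ?_
    rw [hc, hc]
    exact congr($hxy i j • E i j)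
  · have hd {i j : P} {z : B} (hz : i ≤ j → z = E i j) : d i j • z = d i j • E i j := by
      by_cases hij : i ≤ j
      · rw [hz hij]
      · rw [d.apply_eq_zero_of_not_le hij, zero_smul, zero_smul]
    obtain ⟨x, hx⟩ := hπ.exists_mul_mul_eq hE.map_diag hE.orthogonalIdempotents.idem
      (y := fun i j => d i j • E i j) (fun i j => by rw [mul_smul_comm, hd hE.diag_mul])
      (fun i j => by rw [smul_mul_assoc, hd hE.mul_diag])
    exact ⟨x, IncidenceAlgebra.ext fun i j hij => hinj hij ((hc x i j).symm.trans (hx i j))⟩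

section Coordinates

variable (hπ : IsFormalLift k π) (hE : IsFrame π ω E)
  {κ : B ≃ₗ[k⟦X⟧] IncidenceAlgebra k⟦X⟧ P} (hκ : ∀ x i j, E i i * x * E j j = κ x i j • E i j)

include hπ hE hκ

lemma constantCoeff_coordinates (x : B) (i j : P) : constantCoeff (κ x i j) = π x i j := by
  by_cases hij : i ≤ j
  · have := congr(π $(hκ x i j) i j)
    rwa [map_mul, map_mul, hπ.map_smul, hE.map_diag, hE.map_diag, hE.map_eq hij,
      matrixUnit_self_mul_mul_matrixUnit_self, IncidenceAlgebra.constSMul_apply,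
      IncidenceAlgebra.constSMul_apply, matrixUnit_apply_self hij, smul_eq_mul, smul_eq_mul,
      mul_one, mul_one, eq_comm] at this
  · rw [IncidenceAlgebra.apply_eq_zero_of_not_le hij, IncidenceAlgebra.apply_eq_zero_of_not_le hij,
      map_zero]

lemma coordinates_mul (x y : B) {i l : P} (hil : i ≤ l) :
    κ (x * y) i l = ∑ j : Finset.Icc i l,
      ω (simplex₂ (Finset.mem_Icc.1 j.2).1 (Finset.mem_Icc.1 j.2).2) • (κ x i j * κ y j l) := by
  refine hπ.smul_left_injective (v := E i l) (hE.map_eq hil ▸ matrixUnit_ne_zero hil) ?_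
  beta_reduce
  rw [← hκ, hπ.mul_mul_mul_eq_sum hE.map_diag hE.orthogonalIdempotents, Finset.sum_smul]
  refine Finset.sum_congr rfl fun j _ => ?_
  rw [hκ, hκ, smul_mul_smul_comm, hE.mul_eq (Finset.mem_Icc.1 j.2).1 (Finset.mem_Icc.1 j.2).2,
    smul_comm, smul_assoc]

end Coordinates

theorem exists_linearMap {B' : Type*} [Ring B'] [Algebra k⟦X⟧ B']
    {π' : B' →+* IncidenceAlgebra k P} {E' : P → P → B'} (hπ : IsFormalLift k π)
    (hE : IsFrame π ω E) (hπ' : IsFormalLift k π') (hE' : IsFrame π' ω E') :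
    ∃ f : B →ₗ[k⟦X⟧] B', (∀ x, π' (f x) = π x) ∧ ∀ x y, f (x * y) = f x * f y := by
  obtain ⟨κ, hκ⟩ := exists_coordinates hπ hE
  obtain ⟨κ', hκ'⟩ := exists_coordinates hπ' hE'
  have hcoord (x : B) : κ' (κ'.symm (κ x)) = κ x := κ'.apply_symm_apply _
  refine ⟨κ'.symm.toLinearMap ∘ₗ κ.toLinearMap, fun x => ?_, fun x y => κ'.injective ?_⟩
  · ext i j _
    rw [← constantCoeff_coordinates hπ hE hκ, ← constantCoeff_coordinates hπ' hE' hκ', ← hcoord]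
    rfl
  · refine IncidenceAlgebra.ext fun i l hil => ?_
    change κ' (κ'.symm (κ (x * y))) i l = κ' (κ'.symm (κ x) * κ'.symm (κ y)) i l
    rw [hcoord, coordinates_mul hπ hE hκ x y hil, coordinates_mul hπ' hE' hκ' _ _ hil, hcoord,
      hcoord]

end IsFrame

end Frame

section TwistedProduct

variable {P : Type*} [PartialOrder P]

lemma incidenceAlgebra_sum_apply {ι R : Type*} [AddCommMonoid R] (s : Finset ι)
    (f : ι → IncidenceAlgebra R P) (i j : P) : (∑ a ∈ s, f a) i j = ∑ a ∈ s, f a i j :=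
  map_sum (⟨⟨fun x => x i j, rfl⟩, fun _ _ => rfl⟩ : IncidenceAlgebra R P →+ R) f s

variable [LocallyFiniteOrder P]

lemma sum_Icc_sum_Icc_comm {M : Type*} [AddCommMonoid M] {i m : P}
    (f : ∀ ⦃j l : P⦄, i ≤ j → j ≤ l → l ≤ m → M) :
    ∑ l : Finset.Icc i m, ∑ j : Finset.Icc i l.1,
        f (Finset.mem_Icc.1 j.2).1 (Finset.mem_Icc.1 j.2).2 (Finset.mem_Icc.1 l.2).2 =
      ∑ j : Finset.Icc i m, ∑ l : Finset.Icc j.1 m,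
        f (Finset.mem_Icc.1 j.2).1 (Finset.mem_Icc.1 l.2).1 (Finset.mem_Icc.1 l.2).2 := by
  rw [← Fintype.sum_sigma', ← Fintype.sum_sigma']
  have mem {a b c : P} (h : a ≤ b) (h' : b ≤ c) : b ∈ Finset.Icc a c := Finset.mem_Icc.2 ⟨h, h'⟩
  refine Fintype.sum_bijective
    (fun p : Σ l : Finset.Icc i m, Finset.Icc i l.1 =>
      (⟨⟨p.2, Finset.Icc_subset_Icc_right (Finset.mem_Icc.1 p.1.2).2 p.2.2⟩,
        ⟨p.1, mem (Finset.mem_Icc.1 p.2.2).2 (Finset.mem_Icc.1 p.1.2).2⟩⟩ :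
        Σ j : Finset.Icc i m, Finset.Icc j.1 m))
    (Function.bijective_iff_has_inverse.2
      ⟨fun p => ⟨⟨p.2, Finset.Icc_subset_Icc_left (Finset.mem_Icc.1 p.1.2).1 p.2.2⟩,
        ⟨p.1, mem (Finset.mem_Icc.1 p.1.2).1 (Finset.mem_Icc.1 p.2.2).1⟩⟩,
        fun _ => rfl, fun _ => rfl⟩)
    _ _ fun _ => rfl

variable {R : Type*} [CommSemiring R]

/-- The bilinear product `(a, b) ↦ ∑_{i ≤ j ≤ l} w(i, j, l) a(i, j) b(j, l)` on the incidence
algebra: the product of the incidence algebra twisted by the `2`-cochain `w`. -/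
def twistedMul (w : PosetCochain P R 2) :
    IncidenceAlgebra R P →ₗ[R] IncidenceAlgebra R P →ₗ[R] IncidenceAlgebra R P :=
  LinearMap.mk₂ R
    (fun a b => ⟨fun i l => ∑ j : Finset.Icc i l,
        w (simplex₂ (Finset.mem_Icc.1 j.2).1 (Finset.mem_Icc.1 j.2).2) * (a i j * b j l),
      fun i l h => Finset.sum_eq_zero fun j _ =>
        absurd ((Finset.mem_Icc.1 j.2).1.trans (Finset.mem_Icc.1 j.2).2) h⟩)
    (fun a a' b => by
      ext i l _
      simp [add_mul, mul_add, Finset.sum_add_distrib])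
    (fun c a b => by
      ext i l _
      simp [Finset.mul_sum, mul_assoc, mul_left_comm])
    (fun a b b' => by
      ext i l _
      simp [mul_add, Finset.sum_add_distrib])
    (fun c a b => by
      ext i l _
      simp [Finset.mul_sum, mul_left_comm])

lemma twistedMul_apply (w : PosetCochain P R 2) (a b : IncidenceAlgebra R P) (i l : P) :
    twistedMul w a b i l = ∑ j : Finset.Icc i l,
      w (simplex₂ (Finset.mem_Icc.1 j.2).1 (Finset.mem_Icc.1 j.2).2) * (a i j * b j l) := rfl

variable [DecidableEq P]

lemma twistedMul_one_left_apply (w : PosetCochain P R 2) (a : IncidenceAlgebra R P) {i l : P}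
    (hil : i ≤ l) : twistedMul w 1 a i l = w (simplex₂ le_rfl hil) * a i l := by
  rw [twistedMul_apply, Finset.sum_eq_single_of_mem ⟨i, Finset.left_mem_Icc.2 hil⟩
    (Finset.mem_univ _) fun j _ hj => ?_]
  · rw [IncidenceAlgebra.one_apply, if_pos rfl, one_mul]
  · rw [IncidenceAlgebra.one_apply, if_neg fun h => hj (Subtype.ext h.symm), zero_mul, mul_zero]

lemma twistedMul_one_right_apply (w : PosetCochain P R 2) (a : IncidenceAlgebra R P) {i l : P}
    (hil : i ≤ l) : twistedMul w a 1 i l = w (simplex₂ hil le_rfl) * a i l := by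
  rw [twistedMul_apply, Finset.sum_eq_single_of_mem ⟨l, Finset.right_mem_Icc.2 hil⟩
    (Finset.mem_univ _) fun j _ hj => ?_]
  · rw [IncidenceAlgebra.one_apply, if_pos rfl, mul_one]
  · rw [IncidenceAlgebra.one_apply, if_neg fun h => hj (Subtype.ext h), mul_zero, mul_zero]

lemma twistedMul_matrixUnit (w : PosetCochain P R 2) {i j l : P} (hij : i ≤ j) (hjl : j ≤ l) :
    twistedMul w (matrixUnit R i j) (matrixUnit R j l) =
      w (simplex₂ hij hjl) • matrixUnit R i l := by
  ext a b _
  rw [twistedMul_apply, IncidenceAlgebra.constSMul_apply, matrixUnit_apply (hij.trans hjl)]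
  simp only [matrixUnit_apply hij, matrixUnit_apply hjl]
  by_cases h : a = i ∧ b = l
  · obtain ⟨rfl, rfl⟩ := h
    rw [Finset.sum_eq_single_of_mem ⟨j, Finset.mem_Icc.2 ⟨hij, hjl⟩⟩ (Finset.mem_univ _)]
    · simp
    · rintro ⟨m, hm⟩ - hne
      rw [if_neg fun h => hne (Subtype.ext h.2), zero_mul, mul_zero]
  · rw [if_neg h, smul_zero]
    refine Finset.sum_eq_zero fun m _ => ?_
    split_ifs <;> simp_all

lemma twistedMul_matrixUnit_self_of_ne (w : PosetCochain P R 2) {i j : P} (hij : i ≠ j) :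
    twistedMul w (matrixUnit R i i) (matrixUnit R j j) = 0 := by
  ext a b _
  rw [twistedMul_apply]
  simp only [matrixUnit_apply le_rfl]
  refine Finset.sum_eq_zero fun m _ => ?_
  split_ifs <;> simp_all

end TwistedProduct

section CocycleDeformation

variable {k P : Type*} [Field k] [PartialOrder P] [LocallyFiniteOrder P]
  [DecidableEq P]

/-- The `(i, j)` entry of a power series over the incidence algebra, as a scalar power series. -/
noncomputable def entrySeries (x : (IncidenceAlgebra k P)⟦X⟧) (i j : P) : k⟦X⟧ :=
  PowerSeries.mk fun n => coeff n x i j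

lemma coeff_entrySeries (x : (IncidenceAlgebra k P)⟦X⟧) (i j : P) (n : ℕ) :
    coeff n (entrySeries x i j) = coeff n x i j :=
  coeff_mk _ _

lemma entrySeries_ext {x y : (IncidenceAlgebra k P)⟦X⟧}
    (h : ∀ ⦃i j⦄, i ≤ j → entrySeries x i j = entrySeries y i j) : x = y := by
  ext n i j hij
  rw [← coeff_entrySeries, h hij, coeff_entrySeries]

/-- The coefficients `w₀, w₁, …` of a cochain `w` of power series twist the product of the incidence
algebra `A`; this is the family of products so obtained, whose extension to `A[[λ]]` is the product
twisted by `w`. -/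
noncomputable def twistedTerm (w : PosetCochain P k⟦X⟧ 2) (n : ℕ) :
    IncidenceAlgebra k P →ₗ[k] IncidenceAlgebra k P →ₗ[k] IncidenceAlgebra k P :=
  twistedMul fun v => coeff n (w v)

lemma entrySeries_formalExtend₂ (w : PosetCochain P k⟦X⟧ 2) (x y : (IncidenceAlgebra k P)⟦X⟧)
    (i l : P) : entrySeries (formalExtend₂ (twistedTerm w) x y) i l = ∑ j : Finset.Icc i l,
      w (simplex₂ (Finset.mem_Icc.1 j.2).1 (Finset.mem_Icc.1 j.2).2) *
        (entrySeries x i j * entrySeries y j l) := by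
  ext n
  rw [coeff_entrySeries, formalExtend₂, coeff_mk, map_sum]
  simp only [incidenceAlgebra_sum_apply, twistedTerm, twistedMul_apply, coeff_mul,
    coeff_entrySeries, Finset.mul_sum]
  rw [Finset.sum_comm]
  simp only [Finset.sum_comm (s := (Finset.univ : Finset (Finset.Icc i l)))]

lemma formalExtend₂_twistedTerm_assoc {w : PosetCochain P k⟦X⟧ 2}
    (hw : ∀ ⦃i j l m : P⦄ (hij : i ≤ j) (hjl : j ≤ l) (hlm : l ≤ m),
      w (simplex₂ hij hjl) * w (simplex₂ (hij.trans hjl) hlm) =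
        w (simplex₂ hjl hlm) * w (simplex₂ hij (hjl.trans hlm)))
    (x y z : (IncidenceAlgebra k P)⟦X⟧) :
    formalExtend₂ (twistedTerm w) (formalExtend₂ (twistedTerm w) x y) z =
      formalExtend₂ (twistedTerm w) x (formalExtend₂ (twistedTerm w) y z) := by
  refine entrySeries_ext fun i m _ => ?_
  simp only [entrySeries_formalExtend₂, Finset.mul_sum, Finset.sum_mul]
  rw [sum_Icc_sum_Icc_comm fun j l hij hjl hlm =>
    w (simplex₂ (hij.trans hjl) hlm) * (w (simplex₂ hij hjl) *
      (entrySeries x i j * entrySeries y j l) * entrySeries z l m)]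
  refine Finset.sum_congr rfl fun j _ => Finset.sum_congr rfl fun l _ => ?_
  linear_combination (entrySeries x i j * entrySeries y j l * entrySeries z l m) *
    hw (Finset.mem_Icc.1 j.2).1 (Finset.mem_Icc.1 l.2).1 (Finset.mem_Icc.1 l.2).2

variable {ω : PosetCochain P (BigWittGroup k) 2}

theorem IsNormalizedCochain.exists_isGivenBy (hω : IsNormalizedCochain ω)
    (hω_cocycle : ω ∈ PosetZ2 P (BigWittGroup k)) :
    ∃ F : FormalDeformation k (IncidenceAlgebra k P), F.IsGivenBy ω := by
  let w : PosetCochain P k⟦X⟧ 2 := fun v => ((ω v : k⟦X⟧ˣ) : k⟦X⟧)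
  have hw_left {i l : P} (hil : i ≤ l) : w (simplex₂ le_rfl hil) = 1 :=
    congr((($((hω hil).1) : k⟦X⟧ˣ) : k⟦X⟧))
  have hw_right {i l : P} (hil : i ≤ l) : w (simplex₂ hil le_rfl) = 1 :=
    congr((($((hω hil).2) : k⟦X⟧ˣ) : k⟦X⟧))
  refine ⟨⟨twistedTerm w, fun a b => ?_, formalExtend₂_twistedTerm_assoc fun i j l m hij hjl hlm =>
    congr((($(mem_posetZ2_iff.1 hω_cocycle hij hjl hlm) : k⟦X⟧ˣ) : k⟦X⟧)),
    fun a => ?_, fun a => ?_⟩, fun _ _ _ _ _ => rfl⟩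
  · ext i l _
    rw [IncidenceAlgebra.mul_apply, ← Finset.sum_coe_sort, twistedTerm, twistedMul_apply]
    simp only [coeff_zero_eq_constantCoeff_apply, w, BigWittGroup.constantCoeff_coe, one_mul]
  · ext n i l hil
    rw [coeff_formalExtend₂_C, twistedTerm, twistedMul_one_left_apply _ _ hil, hw_left, coeff_one,
      coeff_C]
    split_ifs <;> simp
  · ext n i l hil
    rw [coeff_formalExtend₂_C, twistedTerm, twistedMul_one_right_apply _ _ hil, hw_right, coeff_one,
      coeff_C]
    split_ifs <;> simp

namespace FormalDeformation.IsGivenBy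

variable {F : FormalDeformation k (IncidenceAlgebra k P)}

lemma term_eq (h : F.IsGivenBy ω) : F.term = twistedTerm fun v => ((ω v : k⟦X⟧ˣ) : k⟦X⟧) := by
  funext n
  ext a b i l _
  exact h n a b i l

lemma isNormalizedCochain (h : F.IsGivenBy ω) : IsNormalizedCochain ω := fun i l hil => by
  constructor <;> refine Subtype.ext (Units.ext (PowerSeries.ext fun n => ?_))
  · have := congr(coeff n $(F.one_left (matrixUnit k i l)) i l)
    rw [coeff_formalExtend₂_C, h.term_eq, twistedTerm, twistedMul_one_left_apply _ _ hil,
      matrixUnit_apply_self hil, mul_one, coeff_C] at this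
    refine this.trans ?_
    change _ = coeff n 1
    rw [coeff_one]
    split_ifs
    exacts [matrixUnit_apply_self hil, rfl]
  · have := congr(coeff n $(F.one_right (matrixUnit k i l)) i l)
    rw [coeff_formalExtend₂_C, h.term_eq, twistedTerm, twistedMul_one_right_apply _ _ hil,
      matrixUnit_apply_self hil, mul_one, coeff_C] at this
    refine this.trans ?_
    change _ = coeff n 1
    rw [coeff_one]
    split_ifs
    exacts [matrixUnit_apply_self hil, rfl]

attribute [local instance] seriesModule in
lemma isFrame (h : F.IsGivenBy ω) :
    IsFrame F.red ω fun i j => F.toSeries.symm (C (matrixUnit k i j)) where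
  isNormalizedCochain := h.isNormalizedCochain
  map_eq i j _ := coeff_zero_C _
  mul_eq i j l hij hjl := F.toSeries.injective <| PowerSeries.ext fun n => by
    rw [toSeries_mul, mul, BigWittGroup.smul_def, map_smul]
    simp only [LinearEquiv.apply_symm_apply]
    rw [coeff_formalExtend₂_C, coeff_smul_C, h.term_eq, twistedTerm, twistedMul_matrixUnit]
  diag_mul_diag_eq_zero i j hij := F.toSeries.injective <| PowerSeries.ext fun n => by
    rw [toSeries_mul, mul]
    simp only [LinearEquiv.apply_symm_apply]
    rw [coeff_formalExtend₂_C, h.term_eq, twistedTerm, twistedMul_matrixUnit_self_of_ne _ hij,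
      map_zero, map_zero]

end FormalDeformation.IsGivenBy

end CocycleDeformation

section Classification

variable {k P : Type*} [Field k] [PartialOrder P] [LocallyFiniteOrder P] [DecidableEq P]

namespace FormalDeformation

lemma toClass_eq_toClass_iff {A : Type*} [Ring A] [Algebra k A] {F F' : FormalDeformation k A} :
    F.toClass = F'.toClass ↔ F.Equivalent F' :=
  Quotient.eq

theorem IsGivenBy.toClass_eq_toClass_iff {F F' : FormalDeformation k (IncidenceAlgebra k P)}
    {ω ω' : PosetZ2 P (BigWittGroup k)} (h : F.IsGivenBy ω.1) (h' : F'.IsGivenBy ω'.1) :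
    F.toClass = F'.toClass ↔
      (QuotientGroup.mk ω : PosetH2 P (BigWittGroup k)) = QuotientGroup.mk ω' := by
  rw [FormalDeformation.toClass_eq_toClass_iff, equivalent_iff, posetH2_mk_eq_mk_iff]
  constructor
  · rintro ⟨f, hred, hmul⟩
    exact h.isFrame.cohomologous F.isFormalLift_red (h'.isFrame.map hred hmul)
  · rintro ⟨φ, hφ⟩
    obtain ⟨V, hV⟩ := h.isFrame.exists_of_coboundary F.isFormalLift_red h'.isNormalizedCochain hφ
    exact h'.isFrame.exists_linearMap F'.isFormalLift_red F.isFormalLift_red hV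

theorem exists_isGivenBy_toClass_eq (F : FormalDeformation k (IncidenceAlgebra k P)) :
    ∃ (ω : PosetZ2 P (BigWittGroup k)) (F' : FormalDeformation k (IncidenceAlgebra k P)),
      F'.IsGivenBy ω.1 ∧ F'.toClass = F.toClass := by
  obtain ⟨ω, E, hE⟩ := F.isFormalLift_red.exists_isFrame
  have hω : ω ∈ PosetZ2 P (BigWittGroup k) := hE.mem_posetZ2 F.isFormalLift_red
  obtain ⟨F', hF'⟩ := hE.isNormalizedCochain.exists_isGivenBy hω
  exact ⟨⟨ω, hω⟩, F', hF', toClass_eq_toClass_iff.2 <| equivalent_iff.2 <|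
    hE.exists_linearMap F.isFormalLift_red F'.isFormalLift_red hF'.isFrame⟩

end FormalDeformation

end Classification

theorem mainTheorem8_general {k : Type*} [Field k]
    {P : Type*} [PartialOrder P] [LocallyFiniteOrder P] [DecidableEq P] :
    (∀ c : PosetH2 P (BigWittGroup k), ∃ ω : PosetZ2 P (BigWittGroup k),
      (QuotientGroup.mk ω : PosetH2 P (BigWittGroup k)) = c ∧
        ∃ F : FormalDeformation k (IncidenceAlgebra k P), F.IsGivenBy ω.1) ∧
    ∃! Ψ : PosetH2 P (BigWittGroup k) ≃ DeformationClasses k (IncidenceAlgebra k P),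
      ∀ (ω : PosetZ2 P (BigWittGroup k)) (F : FormalDeformation k (IncidenceAlgebra k P)),
        F.IsGivenBy ω.1 → Ψ (QuotientGroup.mk ω) = F.toClass := by
  have hexists (c : PosetH2 P (BigWittGroup k)) : ∃ ω : PosetZ2 P (BigWittGroup k),
      (QuotientGroup.mk ω : PosetH2 P (BigWittGroup k)) = c ∧
        ∃ F : FormalDeformation k (IncidenceAlgebra k P), F.IsGivenBy ω.1 := by
    obtain ⟨ω, hc, hω⟩ := exists_isNormalizedCochain_mk_eq c
    exact ⟨ω, hc, hω.exists_isGivenBy ω.2⟩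
  refine ⟨hexists, ?_⟩
  choose rep hrep F hF using hexists
  have hF_mk (ω : PosetZ2 P (BigWittGroup k)) (F' : FormalDeformation k (IncidenceAlgebra k P))
      (h : F'.IsGivenBy ω.1) : (F (QuotientGroup.mk ω)).toClass = F'.toClass :=
    ((hF _).toClass_eq_toClass_iff h).2 (hrep _)
  have hinj : Function.Injective fun c => (F c).toClass := fun c d h => by
    rw [← hrep c, ← hrep d, ← (hF c).toClass_eq_toClass_iff (hF d)]
    exact h
  have hsurj : Function.Surjective fun c => (F c).toClass := fun q => by
    obtain ⟨F₀, rfl⟩ := Quotient.exists_rep q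
    obtain ⟨ω, F', h, hclass⟩ := F₀.exists_isGivenBy_toClass_eq
    exact ⟨QuotientGroup.mk ω, (hF_mk ω F' h).trans hclass⟩
  refine ⟨Equiv.ofBijective _ ⟨hinj, hsurj⟩, hF_mk, fun Ψ hΨ => Equiv.ext fun c => ?_⟩
  exact (congrArg Ψ (hrep c)).symm.trans (hΨ (rep c) (F c) (hF c))

theorem mainTheorem8 {k : Type*} [Field k] [CharZero k]
    {P : Type*} [PartialOrder P] [LocallyFiniteOrder P] [DecidableEq P] :
    (∀ c : PosetH2 P (BigWittGroup k), ∃ ω : PosetZ2 P (BigWittGroup k),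
      (QuotientGroup.mk ω : PosetH2 P (BigWittGroup k)) = c ∧
        ∃ F : FormalDeformation k (IncidenceAlgebra k P), F.IsGivenBy ω.1) ∧
    ∃! Ψ : PosetH2 P (BigWittGroup k) ≃ DeformationClasses k (IncidenceAlgebra k P),
      ∀ (ω : PosetZ2 P (BigWittGroup k)) (F : FormalDeformation k (IncidenceAlgebra k P)),
        F.IsGivenBy ω.1 → Ψ (QuotientGroup.mk ω) = F.toClass :=
  mainTheorem8_general
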